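/- Conventions. Manifolds are smooth, connected and without boundary; $r$ denotes the distance from a point $p$, $\nabla$ the gradient and $\Delta=\operatorname{div}\nabla$ the Laplace–Beltrami operator. A Riemannian manifold $M$ satisfies the Omori–Yau maximum principle if for every $C^2$ function $g:M\to\mathbb R$ bounded from above and every $\varepsilon>0$ there is $x\in M$ with $|g(x)-\sup_M g|<\varepsilon$, $|\nabla g(x)|<\varepsilon$ and $\Delta g(x)<\varepsilon$. A Hadamard manifold is a complete simply connected Riemannian manifold of nonpositive sectional curvature. $M^n$ is rotationally symmetric around $p$ if there is a diffeomorphism $\Phi:\mathbb R^n\to M$ with $\Phi(0)=p$ in whose polar coordinates the metric is $dr^2+f(r)^2d\theta^2$ on $\mathbb R^n\setminus\{0\}$, for some function $f>0$ on $(0,\infty)$, where $d\theta^2$ is the metric of the unit sphere. Let $G:[0,\infty)\to\mathbb R$ be differentiable with $$G\ge 1,\qquad G'\ge 0,\qquad \int_0^\infty \frac{dt}{G(t)}<\infty .$$ (a) (Lemma) There is a $C^1$ function $H:[0,\infty)\to\mathbb R$ such that $$H\ge \tfrac12,\quad H'\ge 0,\quad 2H\le G,\quad H'\le H^2\quad\text{and}\quad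 \int_0^\infty\frac{dt}{H(t)}<\infty .\tag{1}$$ (b) Let $M^n$, $n\ge 1$, be a Hadamard manifold that is rotationally symmetric around $p\in M$, and suppose that $\Delta r(x)>G(r(x))$ for all $x\in M\setminus\{p\}$. Then for every $C^1$ function $H$ satisfying (1) the function $$h(x)=\int_0^{r(x)}\frac{dt}{H(t)}$$ is bounded on $M$, is of class $C^2$ on $M\setminus\{p\}$, and satisfies $\Delta h>1$ on $M\setminus\{p\}$. Moreover, $M$ does not satisfy the Omori–Yau maximum principle. (c) (Sharpness of the condition $\int_0^\infty dt/G=\infty$ in the theorem that a complete $M$ with $\Delta r\le G(r)$ wherever $r$ is smooth and $r>1$ satisfies the principle.) For every $n\ge 2$ there are a complete $n$-dimensional Riemannian manifold $M$ and a point $p\in M$ such that $\Delta r(x)\le G(r(x))$ at every $x\in M$ where $r$ is smooth and $r(x)>1$, but $M$ does not satisfy the Omori–Yau maximum principle. -/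

import Mathlib

open Set Bundle Manifold MeasureTheory
open scoped ContDiff Manifold Topology

universe u

noncomputable section

/-- Conditions on the growth function: `G` is differentiable on `[0, ∞)` (one-sidedly at `0`), with
`G ≥ 1` and `G' ≥ 0` there. Values of `G` on `(-∞, 0)` play no role. -/
structure IsGrowthFunction (G : ℝ → ℝ) : Prop where
  differentiableOn : DifferentiableOn ℝ G (Ici 0)
  one_le : ∀ t, 0 ≤ t → 1 ≤ G t
  deriv_nonneg : ∀ t, 0 ≤ t → 0 ≤ derivWithin G (Ici 0) t

/-- `∫₀^∞ dt / F(t) < ∞`. -/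
def FiniteReciprocalIntegral (F : ℝ → ℝ) : Prop :=
  IntegrableOn (fun t => 1 / F t) (Ici 0)

/-- `H` is of class `C¹` on `[0, ∞)` with `H ≥ 1/2`, `H' ≥ 0`, `2H ≤ G`, `H' ≤ H²` and
`∫₀^∞ dt / H < ∞`. -/
structure IsTamedMinorant (G H : ℝ → ℝ) : Prop where
  contDiffOn : ContDiffOn ℝ 1 H (Ici 0)
  half_le : ∀ t, 0 ≤ t → 1 / 2 ≤ H t
  deriv_nonneg : ∀ t, 0 ≤ t → 0 ≤ derivWithin H (Ici 0) t
  two_mul_le : ∀ t, 0 ≤ t → 2 * H t ≤ G t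
  deriv_le_sq : ∀ t, 0 ≤ t → derivWithin H (Ici 0) t ≤ H t ^ 2
  finite_integral : FiniteReciprocalIntegral H

/-- The model space `ℝⁿ`. -/
abbrev Model (n : ℕ) : Type := EuclideanSpace ℝ (Fin n)

section Riemannian

variable {n : ℕ} {M : Type*} [MetricSpace M] [ChartedSpace (Model n) M]

section Smooth

variable [IsManifold 𝓘(ℝ, Model n) ∞ M]
  [RiemannianBundle (fun x : M => TangentSpace 𝓘(ℝ, Model n) x)]

/-- The Riemannian gradient: `⟪∇u(x), v⟫ = du(x) v` for all `v ∈ T_x M`. -/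
def riemGradient (u : M → ℝ) (x : M) : TangentSpace 𝓘(ℝ, Model n) x :=
  haveI : FiniteDimensional ℝ (TangentSpace 𝓘(ℝ, Model n) x) :=
    inferInstanceAs (FiniteDimensional ℝ (Model n))
  haveI : CompleteSpace (TangentSpace 𝓘(ℝ, Model n) x) := FiniteDimensional.complete ℝ _
  (InnerProductSpace.toDual ℝ (TangentSpace 𝓘(ℝ, Model n) x)).symm
    (mvfderiv 𝓘(ℝ, Model n) u x)

/-- An affine connection, i.e. a covariant derivative on the tangent bundle. In Mathlib's
convention `cov Y x (X x)` is `(∇_X Y)(x)`. -/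
abbrev AffineConnection (n : ℕ) (M : Type*) [MetricSpace M] [ChartedSpace (Model n) M]
    [IsManifold 𝓘(ℝ, Model n) ∞ M] : Type _ :=
  CovariantDerivative 𝓘(ℝ, Model n) (Model n)
    (fun x : M => TangentSpace 𝓘(ℝ, Model n) x)

/-- The Levi-Civita connection: torsion-free and compatible with the metric. -/
def IsLeviCivita [IsContMDiffRiemannianBundle 𝓘(ℝ, Model n) ∞ (Model n)
      (fun x : M => TangentSpace 𝓘(ℝ, Model n) x)]
    (cov : AffineConnection n M) : Prop :=
  haveI : IsContMDiffRiemannianBundle 𝓘(ℝ, Model n) 1 (Model n)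
      (fun x : M => TangentSpace 𝓘(ℝ, Model n) x) :=
    IsContMDiffRiemannianBundle.of_le (n := ∞) (by norm_cast)
  cov.torsion = 0 ∧ cov.IsMetricCompatible

/-- The Laplace-Beltrami operator `Δu = div ∇u`, the trace of `v ↦ ∇_v (∇u)`, where `cov` is the
Levi-Civita connection. -/
def laplaceBeltrami (cov : AffineConnection n M) (u : M → ℝ) (x : M) : ℝ :=
  LinearMap.trace ℝ (TangentSpace 𝓘(ℝ, Model n) x)
    (cov (riemGradient u) x).toLinearMap

/-- The curvature
`R(X,Y)Z = ∇_X ∇_Y Z - ∇_Y ∇_X Z - ∇_[X,Y] Z`. -/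
def curvature (cov : AffineConnection n M)
    (X Y Z : ∀ x : M, TangentSpace 𝓘(ℝ, Model n) x) (x : M) :
    TangentSpace 𝓘(ℝ, Model n) x :=
  cov (fun y => cov Z y (Y y)) x (X x) - cov (fun y => cov Z y (X y)) x (Y x)
    - cov Z x (VectorField.mlieBracket 𝓘(ℝ, Model n) X Y x)

/-- All sectional curvatures are `≤ 0`: `⟪R(X,Y)Y, X⟫ ≤ 0` for all smooth vector fields. -/
def NonposSectionalCurvature (cov : AffineConnection n M) : Prop :=
  ∀ X Y : ∀ x : M, TangentSpace 𝓘(ℝ, Model n) x,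
    ContMDiff 𝓘(ℝ, Model n) (𝓘(ℝ, Model n).prod 𝓘(ℝ, Model n)) ∞
      (fun x => (⟨x, X x⟩ : TangentBundle 𝓘(ℝ, Model n) M)) →
    ContMDiff 𝓘(ℝ, Model n) (𝓘(ℝ, Model n).prod 𝓘(ℝ, Model n)) ∞
      (fun x => (⟨x, Y x⟩ : TangentBundle 𝓘(ℝ, Model n) M)) →
    ∀ x : M, inner ℝ (curvature cov X Y Y x) (X x) ≤ 0

/-- A Hadamard manifold is a complete simply connected Riemannian manifold of nonpositive sectional
curvature (`cov` is the Levi-Civita connection). -/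
structure IsHadamard (cov : AffineConnection n M) : Prop where
  complete : CompleteSpace M
  simplyConnected : SimplyConnectedSpace M
  nonpos : NonposSectionalCurvature cov

/-- The Omori-Yau maximum principle (`cov` is the Levi-Civita connection): for each `C²` function
`g` bounded from above and each `ε > 0` there is a point `x` with
`|g(x) - sup g| < ε`, `|∇g(x)| < ε` and `Δg(x) < ε`. -/
def OmoriYau (cov : AffineConnection n M) : Prop :=
  ∀ g : M → ℝ, ContMDiff 𝓘(ℝ, Model n) 𝓘(ℝ, ℝ) 2 g → BddAbove (range g) →
    ∀ ε : ℝ, 0 < ε → ∃ x : M, |g x - sSup (range g)| < ε ∧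
      ‖(riemGradient g x : TangentSpace 𝓘(ℝ, Model n) x)‖ < ε ∧ laplaceBeltrami cov g x < ε

end Smooth

/-- `M` is rotationally symmetric around `p`: it has global polar coordinates centred at `p` in
which the metric is `dr² + f(r)² dθ²` for a positive warping function `f`. For `y ≠ 0` in `ℝⁿ` the
form `dr` is `u ↦ ⟪u, y⟫ / |y|`, and the metric `dθ²` of the unit sphere pulls back under
`y ↦ y / |y|` to `(⟪u, v⟫ - dr(u) dr(v)) / |y|²`. -/
def IsRotationallySymmetric [RiemannianBundle (fun x : M => TangentSpace 𝓘(ℝ, Model n) x)]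
    (p : M) : Prop :=
  ∃ (f : ℝ → ℝ) (Φ : Diffeomorph 𝓘(ℝ, Model n) 𝓘(ℝ, Model n) (Model n) M ∞),
    (∀ t, 0 < t → 0 < f t) ∧ Φ 0 = p ∧
    ∀ y : Model n, y ≠ 0 → ∀ u v : Model n,
      inner ℝ (mfderiv 𝓘(ℝ, Model n) 𝓘(ℝ, Model n) Φ y u)
          (mfderiv 𝓘(ℝ, Model n) 𝓘(ℝ, Model n) Φ y v) =
        (inner ℝ u y / ‖y‖) * (inner ℝ v y / ‖y‖)
          + f ‖y‖ ^ 2 * ((inner ℝ u v - (inner ℝ u y / ‖y‖) * (inner ℝ v y / ‖y‖)) / ‖y‖ ^ 2)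

end Riemannian

end

/-!
The theorem rests on one computation: in polar coordinates around the pole of a rotationally
symmetric metric `dr² + f(r)² dθ²`, the distance function is the Euclidean norm, its gradient is the
radial field, and `Δ(φ(r)) = φ''(r) + φ'(r) Δr`.

*The tamed minorant.* For `u = 1/H` the conditions `H' ≥ 0`, `H' ≤ H²` and `2H ≤ G` say that `u` is
decreasing with slope at least `-1` and that `u ≥ 2/G`. Averaging the decreasing function `2/G`,
which takes values in `[0, 2]`, over windows `[t - 2, t]` gives such a function, and it remains
integrable because it is at most `2/G(t - 2)`. A second, smooth average makes it smooth
(`IsGrowthFunction.exists_contDiff_isTamedMinorant`), as needed for the sharp example.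

*The unbounded Laplacian.* For `h = ∫₀^r dt/H` one has `Δh = Δr/H - H'/H²`. With `Δr > G ≥ 2H` and
`H' ≤ H²` this exceeds `2 - 1 = 1` (`IsPolarChart.integral_comp_dist`). The function `h` is bounded
but not `C²` at the pole; a cutoff of the integrand near `0` makes it so without changing it, up to
a constant, for `r ≥ 1`. The modified function is strictly increasing in `r` there, so that any
point at which it is close to its supremum has `r > 1`, where its Laplacian is at least `1`
(`IsPolarChart.not_omoriYau`). This argument needs only `Δr ≥ 2H(r)` for `r > 1`. That `r` is the
Euclidean norm in the polar chart holds because `dr` has norm `1` and rays have unit speed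
(`IsPolarChart.dist_eq_norm`).

*Sharpness.* Since `Δr = (n - 1) f'(r)/f(r)`, prescribing `f'/f = 2H/(n - 1)` for `r > 1` and
`f(r) = r` for `r ≤ 1/2` gives a smooth complete metric on `ℝⁿ` with `Δr = 2H(r) ≤ G(r)` for
`r > 1`, to which the previous argument applies. The Levi-Civita connection of this metric is
written with Christoffel symbols obtained from the Koszul formula (`exists_isChristoffel`), and `Δr`
is read off from the covariant derivative of the radial field (`radial_covariant_derivative`).
-/

/-! ### A smooth minorant of the growth function -/

noncomputable section

/-- A smooth probability density on `ℝ`, supported in `[0, 2]`. -/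
def oneSidedBump : ContDiffBump (1 : ℝ) where
  rIn := 1 / 2
  rOut := 1
  rIn_pos := by norm_num
  rIn_lt_rOut := by norm_num

lemma mem_Icc_of_oneSidedBump_ne_zero {s : ℝ} (hs : oneSidedBump.normed volume s ≠ 0) :
    s ∈ Icc (0 : ℝ) 2 := by
  have h : s ∈ Function.support (oneSidedBump.normed volume) := hs
  rw [ContDiffBump.support_normed_eq, Metric.mem_ball, Real.dist_eq] at h
  have h' : |s - 1| < 1 := h
  rw [abs_lt] at h'
  exact ⟨by linarith, by linarith⟩

/-- The average of `v` over `[t - 2, t]` for a smooth density. -/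
def oneSidedAverage (v : ℝ → ℝ) (t : ℝ) : ℝ :=
  ∫ s, oneSidedBump.normed volume s * v (t - s)

lemma contDiff_oneSidedAverage {v : ℝ → ℝ} (hv : Continuous v) :
    ContDiff ℝ ∞ (oneSidedAverage v) :=
  oneSidedBump.hasCompactSupport_normed.contDiff_convolution_left (ContinuousLinearMap.mul ℝ ℝ)
    (μ := volume) (n := ⊤) oneSidedBump.contDiff_normed hv.locallyIntegrable

lemma integrable_oneSidedBump_mul {v : ℝ → ℝ} (hv : Continuous v) :
    Integrable fun s => oneSidedBump.normed volume s * v s :=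
  (oneSidedBump.continuous_normed.mul hv).integrable_of_hasCompactSupport
    oneSidedBump.hasCompactSupport_normed.mul_right

/-- Pointwise bounds on the window `[t - 2, t]` pass to the average. -/
lemma integral_oneSidedBump_mul_mono {v v' : ℝ → ℝ} (hv : Continuous v) (hv' : Continuous v')
    (h : ∀ s ∈ Icc (0 : ℝ) 2, v s ≤ v' s) :
    ∫ s, oneSidedBump.normed volume s * v s ≤ ∫ s, oneSidedBump.normed volume s * v' s := by
  refine integral_mono (integrable_oneSidedBump_mul hv) (integrable_oneSidedBump_mul hv')
    fun s => ?_
  rcases eq_or_ne (oneSidedBump.normed volume s) 0 with h0 | h0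
  · simp [h0]
  · exact mul_le_mul_of_nonneg_left (h s (mem_Icc_of_oneSidedBump_ne_zero h0))
      (oneSidedBump.nonneg_normed s)

lemma integral_oneSidedBump_mul_const (c : ℝ) :
    ∫ s, oneSidedBump.normed volume s * c = c := by
  rw [integral_mul_const, ContDiffBump.integral_normed, one_mul]

variable {v : ℝ → ℝ}

lemma antitone_oneSidedAverage (hv : Continuous v) (ha : Antitone v) :
    Antitone (oneSidedAverage v) := fun a b hab =>
  integral_oneSidedBump_mul_mono (by fun_prop) (by fun_prop) fun s _ => ha (by linarith)

lemma le_oneSidedAverage (hv : Continuous v) (ha : Antitone v) (t : ℝ) :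
    v t ≤ oneSidedAverage v t := by
  rw [← integral_oneSidedBump_mul_const (v t)]
  exact integral_oneSidedBump_mul_mono (by fun_prop) (by fun_prop)
    fun s hs => ha (by linarith [hs.1])

lemma oneSidedAverage_le (hv : Continuous v) (ha : Antitone v) (t : ℝ) :
    oneSidedAverage v t ≤ v (t - 2) := by
  rw [← integral_oneSidedBump_mul_const (v (t - 2))]
  exact integral_oneSidedBump_mul_mono (by fun_prop) (by fun_prop)
    fun s hs => ha (by linarith [hs.2])

lemma monotone_oneSidedAverage_add (hv : Continuous v) (hm : Monotone fun t => v t + t) :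
    Monotone fun t => oneSidedAverage v t + t := by
  intro a b hab
  have h : oneSidedAverage v a ≤ oneSidedAverage v b + (b - a) := by
    unfold oneSidedAverage
    have e : (∫ s, oneSidedBump.normed volume s * v (b - s)) + (b - a) =
        ∫ s, oneSidedBump.normed volume s * (v (b - s) + (b - a)) := by
      simp_rw [mul_add]
      rw [integral_add (integrable_oneSidedBump_mul (by fun_prop))
        (integrable_oneSidedBump_mul continuous_const), integral_oneSidedBump_mul_const]
    rw [e]
    refine integral_oneSidedBump_mul_mono (by fun_prop) (by fun_prop) fun s _ => ?_
    have := hm (show a - s ≤ b - s by linarith)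
    simp only at this
    linarith
  simp only
  linarith

section WindowAverage

/-- The average of `w` over `[t - 2, t]`. -/
def windowAverage (w : ℝ → ℝ) (t : ℝ) : ℝ := (∫ s in (t - 2)..t, w s) / 2

variable {w : ℝ → ℝ}

lemma hasDerivAt_windowAverage (hw : Continuous w) (t : ℝ) :
    HasDerivAt (windowAverage w) ((w t - w (t - 2)) / 2) t := by
  have h1 : ∀ t, HasDerivAt (fun t => ∫ s in (0 : ℝ)..t, w s) (w t) t :=
    fun t => (hw.integral_hasStrictDerivAt 0 t).hasDerivAt
  have h2 : HasDerivAt (fun t => ∫ s in (0 : ℝ)..(t - 2), w s) (w (t - 2)) t :=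
    (h1 (t - 2)).comp_sub_const t 2
  refine (((h1 t).sub h2).div_const 2).congr_of_eventuallyEq
    (Filter.Eventually.of_forall fun τ => ?_)
  simp only [windowAverage, Pi.sub_apply]
  rw [intervalIntegral.integral_interval_sub_left (hw.intervalIntegrable _ _)
    (hw.intervalIntegrable _ _)]

lemma continuous_windowAverage (hw : Continuous w) : Continuous (windowAverage w) :=
  continuous_iff_continuousAt.mpr fun t => (hasDerivAt_windowAverage hw t).continuousAt

lemma antitone_windowAverage (hw : Continuous w) (ha : Antitone w) :
    Antitone (windowAverage w) :=
  antitone_of_deriv_nonpos (fun t => (hasDerivAt_windowAverage hw t).differentiableAt) fun t => by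
    rw [(hasDerivAt_windowAverage hw t).deriv]
    have := ha (show t - 2 ≤ t by linarith)
    linarith

/-- Since `w` takes values in `[0, 2]`, its average over a window of length `2` is `1`-Lipschitz. -/
lemma monotone_windowAverage_add (hw : Continuous w) (h0 : ∀ t, 0 ≤ w t) (h2 : ∀ t, w t ≤ 2) :
    Monotone fun t => windowAverage w t + t := by
  have hd : ∀ t, HasDerivAt (fun t => windowAverage w t + t) ((w t - w (t - 2)) / 2 + 1) t :=
    fun t => (hasDerivAt_windowAverage hw t).add (hasDerivAt_id t)
  refine monotone_of_deriv_nonneg (fun t => (hd t).differentiableAt) fun t => ?_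
  rw [(hd t).deriv]
  linarith [h0 t, h2 (t - 2)]

lemma le_windowAverage (hw : Continuous w) (ha : Antitone w) (t : ℝ) : w t ≤ windowAverage w t := by
  have := intervalIntegral.integral_mono_on (a := t - 2) (b := t) (by linarith)
    (continuous_const.intervalIntegrable (μ := volume) _ _) (hw.intervalIntegrable _ _)
    fun s hs => ha hs.2
  rw [intervalIntegral.integral_const, smul_eq_mul] at this
  unfold windowAverage
  linarith

lemma windowAverage_le (hw : Continuous w) (ha : Antitone w) (t : ℝ) :
    windowAverage w t ≤ w (t - 2) := by
  have := intervalIntegral.integral_mono_on (a := t - 2) (b := t) (by linarith)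
    (hw.intervalIntegrable _ _) (continuous_const.intervalIntegrable (μ := volume) _ _)
    fun s hs => ha hs.1
  rw [intervalIntegral.integral_const, smul_eq_mul] at this
  unfold windowAverage
  linarith

end WindowAverage

/-- The function `2 / G`, extended to the left of `0` by its value at `0`, is averaged twice over
windows of length `2`: once to make it `1`-Lipschitz, once to make it smooth. The result `u` is
antitone, lies between `2 / G(t)` and `2 / G(t - 4)`, and `H = 1 / u` satisfies
`H' / H² = -u' ∈ [0, 1]`. -/
theorem IsGrowthFunction.exists_contDiff_isTamedMinorant {G : ℝ → ℝ} (hG : IsGrowthFunction G)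
    (hfin : FiniteReciprocalIntegral G) :
    ∃ H : ℝ → ℝ, IsTamedMinorant G H ∧ ContDiff ℝ ∞ H := by
  have hGc : Continuous fun t => G (max t 0) :=
    hG.differentiableOn.continuousOn.comp_continuous (by fun_prop) fun t => le_max_right t 0
  have hG1 : ∀ t, 1 ≤ G (max t 0) := fun t => hG.one_le _ (le_max_right t 0)
  have hG0 : ∀ t, 0 < G (max t 0) := fun t => one_pos.trans_le (hG1 t)
  have hGm : MonotoneOn G (Ici 0) := by
    refine monotoneOn_of_deriv_nonneg (convex_Ici 0) hG.differentiableOn.continuousOn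
      (hG.differentiableOn.mono interior_subset) fun t ht => ?_
    rw [interior_Ici] at ht
    rw [← derivWithin_of_mem_nhds (Ici_mem_nhds ht)]
    exact hG.deriv_nonneg t (le_of_lt ht)
  set w : ℝ → ℝ := fun t => 2 / G (max t 0) with hwdef
  have hw : Continuous w := continuous_const.div hGc fun t => (hG0 t).ne'
  have hwa : Antitone w := fun a b hab =>
    div_le_div_of_nonneg_left zero_le_two (hG0 a)
      (hGm (le_max_right a 0) (le_max_right b 0) (max_le_max_right 0 hab))
  have hw0 : ∀ t, 0 < w t := fun t => div_pos two_pos (hG0 t)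
  have hw2 : ∀ t, w t ≤ 2 := fun t => div_le_self zero_le_two (hG1 t)
  set v := windowAverage w
  have hv : Continuous v := continuous_windowAverage hw
  have hva : Antitone v := antitone_windowAverage hw hwa
  set u := oneSidedAverage v
  have hu : ContDiff ℝ ∞ u := contDiff_oneSidedAverage hv
  have hua : Antitone u := antitone_oneSidedAverage hv hva
  have hum : Monotone fun t => u t + t :=
    monotone_oneSidedAverage_add hv (monotone_windowAverage_add hw (fun t => (hw0 t).le) hw2)
  have hwu : ∀ t, w t ≤ u t := fun t =>
    (le_windowAverage hw hwa t).trans (le_oneSidedAverage hv hva t)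
  have huw : ∀ t, u t ≤ w (t - 4) := fun t => by
    have h1 := oneSidedAverage_le hv hva t
    have h2 := windowAverage_le hw hwa (t - 2)
    rw [show t - 2 - 2 = t - 4 by ring] at h2
    exact h1.trans h2
  have hu0 : ∀ t, 0 < u t := fun t => (hw0 t).trans_le (hwu t)
  have hud : ∀ t, HasDerivAt u (deriv u t) t := fun t =>
    (hu.differentiable (by simp) t).hasDerivAt
  have hud0 : ∀ t, deriv u t ≤ 0 := fun t => hua.deriv_nonpos
  have hud1 : ∀ t, -1 ≤ deriv u t := fun t => by
    have := hum.deriv_nonneg (x := t)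
    have hd : HasDerivAt (fun t => u t + t) (deriv u t + 1) t := (hud t).add (hasDerivAt_id t)
    rw [hd.deriv] at this
    linarith
  have hHd : ∀ t, 0 ≤ t → derivWithin (fun t => 1 / u t) (Ici 0) t = -deriv u t / u t ^ 2 := by
    intro t ht
    have : HasDerivAt (fun t => 1 / u t) (-deriv u t / u t ^ 2) t := by
      simp only [one_div]
      exact (hud t).inv (hu0 t).ne'
    exact this.hasDerivWithinAt.derivWithin (uniqueDiffOn_Ici 0 t ht)
  have hHC : ContDiff ℝ ∞ fun t => 1 / u t := contDiff_const.div hu fun t => (hu0 t).ne'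
  refine ⟨fun t => 1 / u t, ⟨(hHC.of_le (by norm_cast)).contDiffOn, ?_, ?_, ?_, ?_, ?_⟩, hHC⟩
  · intro t _
    exact one_div_le_one_div_of_le (hu0 t) ((huw t).trans (hw2 _))
  · intro t ht
    rw [hHd t ht]
    exact div_nonneg (neg_nonneg.mpr (hud0 t)) (sq_nonneg _)
  · intro t ht
    have h1 := hwu t
    simp only [hwdef, max_eq_left ht] at h1
    rw [mul_one_div, div_le_iff₀ (hu0 t)]
    rwa [div_le_iff₀' (one_pos.trans_le (hG.one_le t ht))] at h1
  · intro t ht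
    rw [hHd t ht, one_div, inv_pow, ← one_div]
    have := hud1 t
    gcongr
    linarith
  · simp only [FiniteReciprocalIntegral, one_div_one_div]
    have h1 : IntegrableOn w (Ici 0) := by
      refine IntegrableOn.congr_fun (f := fun t => 2 * (1 / G t)) (hfin.const_mul 2)
        (fun t ht => ?_) measurableSet_Ici
      simp only [hwdef, max_eq_left (show (0 : ℝ) ≤ t from ht)]
      ring
    have h2 : IntegrableOn w (Ici (-4)) := by
      rw [← Icc_union_Ici_eq_Ici (show (-4 : ℝ) ≤ 0 by norm_num)]
      exact (hw.integrableOn_Icc).union h1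
    have h3 : IntegrableOn (fun t => w (t - 4)) (Ici 0) := by
      rw [← integrable_indicator_iff measurableSet_Ici] at h2 ⊢
      refine (h2.comp_sub_right 4).congr (Filter.Eventually.of_forall fun t => ?_)
      simp only [indicator, mem_Ici]
      congr 1
      exact propext ⟨fun h => by linarith, fun h => by linarith⟩
    refine h3.mono' hu.continuous.aestronglyMeasurable (Filter.Eventually.of_forall fun t => ?_)
    rw [Real.norm_of_nonneg (hu0 t).le]
    exact huw t

end

/-! ### Distance and gradient in polar coordinates -/

noncomputable section

lemma mfderiv_diffeomorph_symm_apply {n : ℕ} {M : Type*} [TopologicalSpace M]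
    [ChartedSpace (Model n) M]
    (Φ : Diffeomorph 𝓘(ℝ, Model n) 𝓘(ℝ, Model n) (Model n) M ∞) (y : Model n)
    (v : TangentSpace 𝓘(ℝ, Model n) (Φ y)) :
    mfderiv 𝓘(ℝ, Model n) 𝓘(ℝ, Model n) Φ y
      (mfderiv 𝓘(ℝ, Model n) 𝓘(ℝ, Model n) Φ.symm (Φ y) v) = v := by
  have h1 : MDifferentiableAt 𝓘(ℝ, Model n) 𝓘(ℝ, Model n) Φ (Φ.symm (Φ y)) :=
    Φ.mdifferentiable (by simp) _
  have h2 : MDifferentiableAt 𝓘(ℝ, Model n) 𝓘(ℝ, Model n) Φ.symm (Φ y) :=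
    Φ.symm.mdifferentiable (by simp) _
  have h := mfderiv_comp (Φ y) h1 h2
  have hid : (Φ ∘ Φ.symm : M → M) = id := by ext x; simp
  rw [hid, mfderiv_id] at h
  have h' : (mfderiv 𝓘(ℝ, Model n) 𝓘(ℝ, Model n) Φ (Φ.symm (Φ y)))
      (mfderiv 𝓘(ℝ, Model n) 𝓘(ℝ, Model n) Φ.symm (Φ y) v) = v :=
    (congrArg (fun L => L v) h).symm
  -- `Φ.symm (Φ y)` cannot be rewritten to `y` in place, because the tangent spaces depend on it.
  have e : ∀ z : Model n, z = y → ∀ w : Model n,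
      (mfderiv 𝓘(ℝ, Model n) 𝓘(ℝ, Model n) Φ z : Model n →L[ℝ] Model n) w =
        (mfderiv 𝓘(ℝ, Model n) 𝓘(ℝ, Model n) Φ y : Model n →L[ℝ] Model n) w := by
    rintro _ rfl w; rfl
  exact (e _ (Φ.symm_apply_apply y) _).symm.trans h'

lemma mvfderiv_comp_diffeomorph_symm {n : ℕ} {M : Type*} [TopologicalSpace M]
    [ChartedSpace (Model n) M]
    (Φ : Diffeomorph 𝓘(ℝ, Model n) 𝓘(ℝ, Model n) (Model n) M ∞) {F : Model n → ℝ} (y : Model n)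
    (hF : DifferentiableAt ℝ F y) (v : TangentSpace 𝓘(ℝ, Model n) (Φ y)) :
    mvfderiv 𝓘(ℝ, Model n) (F ∘ Φ.symm) (Φ y) v =
      fderiv ℝ F y (mfderiv 𝓘(ℝ, Model n) 𝓘(ℝ, Model n) Φ.symm (Φ y) v) := by
  have e : Φ.symm (Φ y) = y := Φ.symm_apply_apply y
  have h1 : MDifferentiableAt 𝓘(ℝ, Model n) 𝓘(ℝ, ℝ) F y := hF.mdifferentiableAt
  have key : ∀ z : Model n, z = y → ∀ w : Model n,
      (mvfderiv 𝓘(ℝ, Model n) F z : Model n →L[ℝ] ℝ) w = fderiv ℝ F y w := by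
    rintro _ rfl w
    rw [mvfderiv, mfderiv_eq_fderiv]
    rfl
  rw [mvfderiv_comp_of_eq h1 (Φ.symm.mdifferentiable (by simp) (Φ y)) e]
  exact key _ e _

lemma abs_inner_div_sqrt_le {E : Type*} [NormedAddCommGroup E] [InnerProductSpace ℝ E]
    (δ : ℝ) (u z : E) :
    |inner ℝ u z / Real.sqrt (‖z‖ ^ 2 + δ ^ 2)| ≤ |inner ℝ u z / ‖z‖| := by
  rcases eq_or_ne z 0 with rfl | hz
  · simp
  rw [abs_div, abs_div, abs_norm, abs_of_nonneg (Real.sqrt_nonneg _)]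
  have : 0 < ‖z‖ := norm_pos_iff.mpr hz
  gcongr
  exact Real.le_sqrt_of_sq_le (le_add_of_nonneg_right (sq_nonneg δ))

section RiemannianDistance

variable {n : ℕ} {M : Type*} [MetricSpace M] [ChartedSpace (Model n) M]
  [RiemannianBundle (fun x : M => TangentSpace 𝓘(ℝ, Model n) x)]
  [IsRiemannianManifold 𝓘(ℝ, Model n) M]

/-- A `C¹` function whose differential has norm at most `1` is `1`-Lipschitz for the Riemannian
distance. -/
lemma abs_sub_le_dist_of_abs_mvfderiv_le {w : M → ℝ}
    (hw : ContMDiff 𝓘(ℝ, Model n) 𝓘(ℝ, ℝ) 1 w)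
    (hb : ∀ (x : M) (v : TangentSpace 𝓘(ℝ, Model n) x),
      |mvfderiv 𝓘(ℝ, Model n) w x v| ≤ ‖v‖) (x y : M) :
    |w x - w y| ≤ dist x y := by
  have key : ‖w y - w x‖ₑ ≤ edist x y := by
    rw [IsRiemannianManifold.out (I := 𝓘(ℝ, Model n)) x y]
    refine le_of_forall_gt fun r hr => ?_
    obtain ⟨γ, h0, h1, hγ, hlen⟩ := exists_lt_of_riemannianEDist_lt hr
    refine lt_of_le_of_lt ?_ hlen
    have hc : ContDiffOn ℝ 1 (w ∘ γ) (Icc 0 1) :=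
      contMDiffOn_iff_contDiffOn.mp (hw.comp_contMDiffOn hγ)
    have := enorm_sub_le_lintegral_derivWithin_Icc_of_contDiffOn_Icc hc zero_le_one
    rw [Function.comp_apply, Function.comp_apply, h0, h1] at this
    refine this.trans ?_
    rw [pathELength_eq_lintegral_mfderivWithin_Icc]
    refine setLIntegral_mono' measurableSet_Icc fun t ht => ?_
    have hd : derivWithin (w ∘ γ) (Icc 0 1) t =
        mvfderiv 𝓘(ℝ, Model n) w (γ t)
          (mfderivWithin 𝓘(ℝ, ℝ) 𝓘(ℝ, Model n) γ (Icc 0 1) t (1 : ℝ)) := by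
      have := mfderiv_comp_mfderivWithin t (hw.mdifferentiableAt one_ne_zero)
        (hγ.mdifferentiableOn one_ne_zero t ht)
        (uniqueMDiffWithinAt_iff_uniqueDiffWithinAt.mpr
          (uniqueDiffOn_Icc zero_lt_one t ht))
      rw [mfderivWithin_eq_fderivWithin] at this
      rw [← fderivWithin_derivWithin]
      exact congrArg (fun L => L (1 : ℝ)) this
    rw [hd, enorm_le_iff_norm_le, Real.norm_eq_abs]
    exact hb _ _
  rw [edist_dist, Real.enorm_eq_ofReal_abs] at key
  rw [abs_sub_comm]
  exact (ENNReal.ofReal_le_ofReal_iff dist_nonneg).mp key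

end RiemannianDistance

section Polar

variable {n : ℕ} {M : Type*} [MetricSpace M] [ChartedSpace (Model n) M]
  [RiemannianBundle (fun x : M => TangentSpace 𝓘(ℝ, Model n) x)]

/-- In the coordinates `Φ` on `M` the Riemannian metric is `dr² + f(r)² dθ²`, with `f > 0`. -/
structure IsPolarChart (f : ℝ → ℝ)
    (Φ : Diffeomorph 𝓘(ℝ, Model n) 𝓘(ℝ, Model n) (Model n) M ∞) : Prop where
  pos : ∀ t, 0 < t → 0 < f t
  inner_eq : ∀ y : Model n, y ≠ 0 → ∀ u v : Model n,
    inner ℝ (mfderiv 𝓘(ℝ, Model n) 𝓘(ℝ, Model n) Φ y u)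
        (mfderiv 𝓘(ℝ, Model n) 𝓘(ℝ, Model n) Φ y v) =
      (inner ℝ u y / ‖y‖) * (inner ℝ v y / ‖y‖)
        + f ‖y‖ ^ 2 * ((inner ℝ u v - (inner ℝ u y / ‖y‖) * (inner ℝ v y / ‖y‖)) / ‖y‖ ^ 2)

variable {f : ℝ → ℝ} {Φ : Diffeomorph 𝓘(ℝ, Model n) 𝓘(ℝ, Model n) (Model n) M ∞}

/-- `|dr(v)| ≤ ‖v‖`. -/
lemma IsPolarChart.abs_inner_div_norm_le (h : IsPolarChart f Φ) {y : Model n} (hy : y ≠ 0)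
    (u : Model n) :
    |inner ℝ u y / ‖y‖| ≤ ‖mfderiv 𝓘(ℝ, Model n) 𝓘(ℝ, Model n) Φ y u‖ := by
  refine abs_le_of_sq_le_sq ?_ (norm_nonneg _)
  rw [← real_inner_self_eq_norm_sq, h.inner_eq y hy u u]
  have hy' : 0 < ‖y‖ := norm_pos_iff.mpr hy
  have hcs : (inner ℝ u y / ‖y‖) * (inner ℝ u y / ‖y‖) ≤ inner ℝ u u := by
    rw [div_mul_div_comm, div_le_iff₀ (by positivity)]
    have := real_inner_mul_inner_self_le u y
    rw [real_inner_self_eq_norm_mul_norm y] at this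
    exact this
  have : 0 ≤ f ‖y‖ ^ 2 *
      ((inner ℝ u u - (inner ℝ u y / ‖y‖) * (inner ℝ u y / ‖y‖)) / ‖y‖ ^ 2) := by
    have := sub_nonneg.mpr hcs
    positivity
  nlinarith

/-- Gauss lemma: `⟪N, v⟫ = dr(v)` for the radial field `N`. -/
lemma IsPolarChart.inner_radial (h : IsPolarChart f Φ) {y : Model n} (hy : y ≠ 0)
    (v : Model n) :
    inner ℝ (mfderiv 𝓘(ℝ, Model n) 𝓘(ℝ, Model n) Φ y (‖y‖⁻¹ • y : Model n))
      (mfderiv 𝓘(ℝ, Model n) 𝓘(ℝ, Model n) Φ y v) = inner ℝ v y / ‖y‖ := by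
  have hy' : ‖y‖ ≠ 0 := norm_ne_zero_iff.mpr hy
  rw [h.inner_eq y hy, real_inner_smul_left, real_inner_smul_left, real_inner_self_eq_norm_sq,
    real_inner_comm v y]
  field_simp
  ring

lemma IsPolarChart.norm_radial (h : IsPolarChart f Φ) {y : Model n} (hy : y ≠ 0) :
    ‖mfderiv 𝓘(ℝ, Model n) 𝓘(ℝ, Model n) Φ y (‖y‖⁻¹ • y : Model n)‖ = 1 := by
  have hy' : ‖y‖ ≠ 0 := norm_ne_zero_iff.mpr hy
  rw [← sq_eq_sq₀ (norm_nonneg _) zero_le_one, ← real_inner_self_eq_norm_sq, h.inner_radial hy,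
    real_inner_smul_left, real_inner_self_eq_norm_sq]
  field_simp

variable [IsRiemannianManifold 𝓘(ℝ, Model n) M]

/-- The radial coordinate does not grow faster than arc length, even for curves through the pole,
where the polar form of the metric says nothing. -/
lemma IsPolarChart.norm_le_dist (h : IsPolarChart f Φ) (y : Model n) :
    ‖y‖ ≤ dist (Φ y) (Φ 0) := by
  -- `√(‖y‖² + δ²)` is a smooth approximation of `‖y‖` with differential bounded by `|dr|`.
  have key : ∀ δ : ℝ, 0 < δ → ‖y‖ ≤ dist (Φ y) (Φ 0) + δ := by
    intro δ hδ
    set F : Model n → ℝ := fun z => Real.sqrt (‖z‖ ^ 2 + δ ^ 2) with hF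
    have hpos : ∀ z : Model n, 0 < ‖z‖ ^ 2 + δ ^ 2 := fun z => by positivity
    have hFs : ContDiff ℝ 1 F :=
      (((contDiff_norm_sq ℝ).add contDiff_const).sqrt fun z => (hpos z).ne')
    have hFd : ∀ z v, fderiv ℝ F z v = inner ℝ v z / F z := by
      intro z v
      have h1 : HasFDerivAt (fun z : Model n => ‖z‖ ^ 2 + δ ^ 2) (2 • innerSL ℝ z) z :=
        (hasStrictFDerivAt_norm_sq z).hasFDerivAt.add_const _
      have h2 := h1.sqrt (hpos z).ne'
      rw [h2.fderiv]
      simp only [smul_apply, innerSL_apply_apply, smul_eq_mul, nsmul_eq_mul]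
      rw [real_inner_comm z v]
      simp only [hF]
      push_cast
      field_simp
    have hw : ContMDiff 𝓘(ℝ, Model n) 𝓘(ℝ, ℝ) 1 (F ∘ Φ.symm) :=
      (contMDiff_iff_contDiff.mpr hFs).comp (Φ.symm.contMDiff.of_le (by norm_cast))
    have hb : ∀ (x : M) (v : TangentSpace 𝓘(ℝ, Model n) x),
        |mvfderiv 𝓘(ℝ, Model n) (F ∘ Φ.symm) x v| ≤ ‖v‖ := by
      intro x v
      obtain ⟨z, rfl⟩ : ∃ z, Φ z = x := ⟨Φ.symm x, Φ.apply_symm_apply x⟩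
      let u : Model n := mfderiv 𝓘(ℝ, Model n) 𝓘(ℝ, Model n) Φ.symm (Φ z) v
      have hv : mfderiv 𝓘(ℝ, Model n) 𝓘(ℝ, Model n) Φ z u = v :=
        mfderiv_diffeomorph_symm_apply Φ z v
      have hd : mvfderiv 𝓘(ℝ, Model n) (F ∘ Φ.symm) (Φ z) v = inner ℝ u z / F z :=
        (mvfderiv_comp_diffeomorph_symm Φ z (hFs.differentiable one_ne_zero z) v).trans (hFd z u)
      rw [hd]
      rcases eq_or_ne z 0 with rfl | hz
      · rw [inner_zero_right, zero_div, abs_zero]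
        exact norm_nonneg _
      rw [← hv]
      exact (abs_inner_div_sqrt_le δ u z).trans (h.abs_inner_div_norm_le hz u)
    have := abs_sub_le_dist_of_abs_mvfderiv_le hw hb (Φ y) (Φ 0)
    simp only [Function.comp_apply, Φ.symm_apply_apply, hF, norm_zero] at this
    rw [zero_pow two_ne_zero, zero_add, Real.sqrt_sq hδ.le] at this
    have h3 : ‖y‖ ≤ Real.sqrt (‖y‖ ^ 2 + δ ^ 2) :=
      Real.le_sqrt_of_sq_le (by nlinarith [sq_nonneg δ])
    linarith [le_abs_self (Real.sqrt (‖y‖ ^ 2 + δ ^ 2) - δ)]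
  exact le_of_forall_pos_le_add key

/-- The ray from the pole to `Φ y` has length `‖y‖`. -/
lemma IsPolarChart.dist_le_norm (h : IsPolarChart f Φ) (y : Model n) :
    dist (Φ y) (Φ 0) ≤ ‖y‖ := by
  rcases eq_or_ne y 0 with rfl | hy
  · simp
  have hy' : 0 < ‖y‖ := norm_pos_iff.mpr hy
  have hγ : ContMDiff 𝓘(ℝ, ℝ) 𝓘(ℝ, Model n) 1 (fun t : ℝ => Φ (t • y)) :=
    (Φ.contMDiff.of_le (by norm_cast)).comp
      (contMDiff_iff_contDiff.mpr (contDiff_id.smul contDiff_const))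
  have hle := riemannianEDist_le_pathELength (I := 𝓘(ℝ, Model n)) (x := Φ 0) (y := Φ y)
    (hγ.contMDiffOn (s := Icc 0 1)) (by simp) (by simp) zero_le_one
  rw [← IsRiemannianManifold.out (I := 𝓘(ℝ, Model n)),
    pathELength_eq_lintegral_mfderiv_Ioo] at hle
  have hspeed : ∀ t ∈ Ioo (0 : ℝ) 1,
      ‖mfderiv 𝓘(ℝ, ℝ) 𝓘(ℝ, Model n) (fun t : ℝ => Φ (t • y)) t (1 : ℝ)‖ₑ = ‖y‖ₑ := by
    intro t ht
    have hd : mfderiv 𝓘(ℝ, ℝ) 𝓘(ℝ, Model n) (fun t : ℝ => Φ (t • y)) t (1 : ℝ) =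
        mfderiv 𝓘(ℝ, Model n) 𝓘(ℝ, Model n) Φ (t • y) y := by
      have hs : HasFDerivAt (fun t : ℝ => t • y)
          ((ContinuousLinearMap.id ℝ ℝ).smulRight y) t :=
        (hasFDerivAt_id t).smul_const y
      have := congrArg (fun L => L (1 : ℝ))
        (mfderiv_comp t (Φ.mdifferentiable (by simp) (t • y))
          hs.differentiableAt.mdifferentiableAt)
      rw [mfderiv_eq_fderiv, hs.fderiv] at this
      refine Eq.trans this ?_
      change mfderiv 𝓘(ℝ, Model n) 𝓘(ℝ, Model n) Φ (t • y) ((1 : ℝ) • y) = _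
      rw [one_smul]
    have hty : t • y ≠ 0 := smul_ne_zero ht.1.ne' hy
    have hrad : y = ‖y‖ • (‖t • y‖⁻¹ • (t • y)) := by
      rw [norm_smul, Real.norm_of_nonneg ht.1.le, smul_smul, smul_smul]
      have := ht.1.ne'
      have h1 : ‖y‖ * ((t * ‖y‖)⁻¹ * t) = 1 := by field_simp
      rw [mul_assoc, h1, one_smul]
    have hn : ‖mfderiv 𝓘(ℝ, Model n) 𝓘(ℝ, Model n) Φ (t • y) y‖ = ‖y‖ := by
      have e : mfderiv 𝓘(ℝ, Model n) 𝓘(ℝ, Model n) Φ (t • y) y =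
          ‖y‖ • mfderiv 𝓘(ℝ, Model n) 𝓘(ℝ, Model n) Φ (t • y) (‖t • y‖⁻¹ • (t • y) : Model n) := by
        conv_lhs => enter [2]; rw [hrad]
        exact (mfderiv 𝓘(ℝ, Model n) 𝓘(ℝ, Model n) Φ (t • y)).map_smul _ _
      rw [e, norm_smul, h.norm_radial hty, norm_norm, mul_one]
    rw [hd, ← ofReal_norm, hn, ofReal_norm]
  replace hle := hle.trans_eq (setLIntegral_congr_fun measurableSet_Ioo hspeed)
  simp only [lintegral_const, MeasurableSet.univ, Measure.restrict_apply, univ_inter,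
    Real.volume_Ioo, sub_zero, ENNReal.ofReal_one, mul_one] at hle
  rw [edist_dist, ← ofReal_norm] at hle
  rw [dist_comm]
  exact (ENNReal.ofReal_le_ofReal_iff (norm_nonneg _)).mp hle

/-- Rays through the origin minimize the distance to the pole. -/
lemma IsPolarChart.dist_eq_norm (h : IsPolarChart f Φ) (y : Model n) :
    dist (Φ y) (Φ 0) = ‖y‖ :=
  le_antisymm (h.dist_le_norm y) (h.norm_le_dist y)

end Polar

end

/-! ### The Laplacian of a radial function -/

noncomputable section

section Radial

variable {n : ℕ} {M : Type*} [MetricSpace M] [ChartedSpace (Model n) M]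
  [RiemannianBundle (fun x : M => TangentSpace 𝓘(ℝ, Model n) x)]

lemma inner_riemGradient (w : M → ℝ) (x : M) (v : TangentSpace 𝓘(ℝ, Model n) x) :
    inner ℝ (riemGradient w x : TangentSpace 𝓘(ℝ, Model n) x) v =
      mvfderiv 𝓘(ℝ, Model n) w x v := by
  unfold riemGradient
  have : FiniteDimensional ℝ (TangentSpace 𝓘(ℝ, Model n) x) :=
    inferInstanceAs (FiniteDimensional ℝ (Model n))
  have : CompleteSpace (TangentSpace 𝓘(ℝ, Model n) x) := FiniteDimensional.complete ℝ _
  exact InnerProductSpace.toDual_symm_apply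

lemma riemGradient_eq_of_inner {w : M → ℝ} {x : M} {g : TangentSpace 𝓘(ℝ, Model n) x}
    (h : ∀ v : TangentSpace 𝓘(ℝ, Model n) x, inner ℝ g v = mvfderiv 𝓘(ℝ, Model n) w x v) :
    riemGradient w x = g :=
  ext_inner_right ℝ fun v => (inner_riemGradient w x v).trans (h v).symm

variable {f : ℝ → ℝ} {Φ : Diffeomorph 𝓘(ℝ, Model n) 𝓘(ℝ, Model n) (Model n) M ∞}
  [IsRiemannianManifold 𝓘(ℝ, Model n) M]

lemma IsPolarChart.comp_dist_eq (h : IsPolarChart f Φ) (F : ℝ → ℝ) :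
    (fun x => F (dist x (Φ 0))) = (fun y : Model n => F ‖y‖) ∘ Φ.symm := by
  ext x
  rw [Function.comp_apply, ← h.dist_eq_norm, Φ.apply_symm_apply]

lemma hasFDerivAt_comp_norm {E : Type*} [NormedAddCommGroup E] [InnerProductSpace ℝ E]
    {F : ℝ → ℝ} {F' : ℝ} {y : E} (hy : y ≠ 0) (hF : HasDerivAt F F' ‖y‖) :
    HasFDerivAt (fun z : E => F ‖z‖) ((F' * ‖y‖⁻¹) • innerSL ℝ y) y := by
  have h1 : HasFDerivAt (fun z : E => ‖z‖) (‖y‖⁻¹ • innerSL ℝ y) y := by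
    have h2 := (hasStrictFDerivAt_norm_sq y).hasFDerivAt.sqrt
      (pow_ne_zero 2 (norm_ne_zero_iff.mpr hy))
    have e : (fun z : E => Real.sqrt (‖z‖ ^ 2)) = fun z => ‖z‖ := by
      ext z; exact Real.sqrt_sq (norm_nonneg z)
    rw [e, Real.sqrt_sq (norm_nonneg y)] at h2
    convert! h2 using 1
    rw [← Nat.cast_smul_eq_nsmul ℝ, smul_smul]
    congr 1
    field_simp
    norm_num
  have := hF.comp_hasFDerivAt y h1
  rwa [smul_smul] at this

lemma IsPolarChart.riemGradient_comp_dist (h : IsPolarChart f Φ) {F : ℝ → ℝ} {F' : ℝ}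
    {y : Model n} (hy : y ≠ 0) (hF : HasDerivAt F F' ‖y‖) :
    riemGradient (n := n) (fun x => F (dist x (Φ 0))) (Φ y) =
      F' • mfderiv 𝓘(ℝ, Model n) 𝓘(ℝ, Model n) Φ y (‖y‖⁻¹ • y : Model n) := by
  refine riemGradient_eq_of_inner fun v => ?_
  let u : Model n := mfderiv 𝓘(ℝ, Model n) 𝓘(ℝ, Model n) Φ.symm (Φ y) v
  have hv : mfderiv 𝓘(ℝ, Model n) 𝓘(ℝ, Model n) Φ y u = v :=
    mfderiv_diffeomorph_symm_apply Φ y v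
  have hd := hasFDerivAt_comp_norm hy hF
  have h1 : mvfderiv 𝓘(ℝ, Model n) ((fun z : Model n => F ‖z‖) ∘ Φ.symm) (Φ y) v =
      F' * (inner ℝ u y / ‖y‖) := by
    refine (mvfderiv_comp_diffeomorph_symm Φ y hd.differentiableAt v).trans ?_
    rw [hd.fderiv]
    change (F' * ‖y‖⁻¹) * inner ℝ y u = _
    rw [real_inner_comm u y]
    ring
  rw [h.comp_dist_eq F, h1, real_inner_smul_left, ← h.inner_radial hy, hv]

lemma IsPolarChart.riemGradient_dist (h : IsPolarChart f Φ) {y : Model n} (hy : y ≠ 0) :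
    riemGradient (n := n) (fun x => dist x (Φ 0)) (Φ y) =
      mfderiv 𝓘(ℝ, Model n) 𝓘(ℝ, Model n) Φ y (‖y‖⁻¹ • y : Model n) :=
  (h.riemGradient_comp_dist (F := fun t => t) hy (hasDerivAt_id _)).trans (one_smul _ _)

omit [RiemannianBundle (fun x : M => TangentSpace 𝓘(ℝ, Model n) x)]
  [IsRiemannianManifold 𝓘(ℝ, Model n) M] in
lemma exists_ne_zero_of_ne {x : M} (hx : x ≠ Φ 0) : ∃ y : Model n, y ≠ 0 ∧ Φ y = x := by
  refine ⟨Φ.symm x, fun h0 => hx ?_, Φ.apply_symm_apply x⟩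
  rw [← h0, Φ.apply_symm_apply]

lemma IsPolarChart.riemGradient_comp_dist_eq_smul (h : IsPolarChart f Φ) {F : ℝ → ℝ} {F' : ℝ}
    {x : M} (hx : x ≠ Φ 0) (hF : HasDerivAt F F' (dist x (Φ 0))) :
    riemGradient (n := n) (fun z => F (dist z (Φ 0))) x =
      F' • riemGradient (n := n) (fun z => dist z (Φ 0)) x := by
  obtain ⟨y, hy, rfl⟩ := exists_ne_zero_of_ne hx
  rw [h.dist_eq_norm] at hF
  rw [h.riemGradient_comp_dist hy hF, h.riemGradient_dist hy]

lemma IsPolarChart.norm_riemGradient_dist (h : IsPolarChart f Φ) {x : M} (hx : x ≠ Φ 0) :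
    ‖(riemGradient (n := n) (fun z => dist z (Φ 0)) x : TangentSpace 𝓘(ℝ, Model n) x)‖ = 1 := by
  obtain ⟨y, hy, rfl⟩ := exists_ne_zero_of_ne hx
  rw [h.riemGradient_dist hy, h.norm_radial hy]

lemma IsPolarChart.contMDiffAt_comp_dist (h : IsPolarChart f Φ) {F : ℝ → ℝ} {k : ℕ}
    {x : M} (hx : x ≠ Φ 0) (hF : ContDiffAt ℝ k F (dist x (Φ 0))) :
    ContMDiffAt 𝓘(ℝ, Model n) 𝓘(ℝ, ℝ) k (fun z => F (dist z (Φ 0))) x := by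
  obtain ⟨y, hy, rfl⟩ := exists_ne_zero_of_ne hx
  rw [h.comp_dist_eq F]
  rw [h.dist_eq_norm] at hF
  have h1 : ContDiffAt ℝ k (fun z : Model n => F ‖z‖) y :=
    ContDiffAt.comp y hF (contDiffAt_norm ℝ hy)
  have h2 : ContMDiffAt 𝓘(ℝ, Model n) 𝓘(ℝ, ℝ) k (fun z : Model n => F ‖z‖) (Φ.symm (Φ y)) := by
    rw [Φ.symm_apply_apply]
    exact h1.contMDiffAt
  exact h2.comp (Φ y) (Φ.symm.contMDiff.of_le (by exact_mod_cast le_top)).contMDiffAt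

variable (n) in
/-- The radial unit field `y / ‖y‖` of `ℝⁿ`, as a map into the tangent bundle. -/
def radialSection (z : Model n) : TangentBundle 𝓘(ℝ, Model n) (Model n) :=
  ⟨z, (‖z‖⁻¹ • z : Model n)⟩

variable [IsManifold 𝓘(ℝ, Model n) ∞ M]

/-- Away from the pole the gradient of the distance is the push-forward of the smooth field
`y / ‖y‖` by the polar chart, hence differentiable. -/
lemma IsPolarChart.mdifferentiableAt_riemGradient_dist (h : IsPolarChart f Φ) {x : M}
    (hx : x ≠ Φ 0) :
    MDifferentiableAt 𝓘(ℝ, Model n) (𝓘(ℝ, Model n).prod 𝓘(ℝ, Model n))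
      (fun z => (⟨z, riemGradient (n := n) (fun z => dist z (Φ 0)) z⟩ :
        TangentBundle 𝓘(ℝ, Model n) M)) x := by
  obtain ⟨y, hy, rfl⟩ := exists_ne_zero_of_ne hx
  have hN : MDifferentiableAt 𝓘(ℝ, Model n) (𝓘(ℝ, Model n).prod 𝓘(ℝ, Model n))
      (radialSection n) y := by
    have hd : ContDiffAt ℝ 1 (fun z : Model n => ‖z‖⁻¹ • z) y :=
      ((contDiffAt_norm ℝ hy).inv (norm_ne_zero_iff.mpr hy)).smul contDiffAt_id
    exact (contMDiffAt_vectorSpace_iff_contDiffAt (V := fun z => (‖z‖⁻¹ • z : Model n)).mpr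
      hd).mdifferentiableAt one_ne_zero
  have hT : ContMDiff 𝓘(ℝ, Model n).tangent 𝓘(ℝ, Model n).tangent 1
      (tangentMap 𝓘(ℝ, Model n) 𝓘(ℝ, Model n) Φ) :=
    Φ.contMDiff.contMDiff_tangentMap (by norm_cast)
  have e : Φ.symm (Φ y) = y := Φ.symm_apply_apply y
  have hcomp : MDifferentiableAt 𝓘(ℝ, Model n) 𝓘(ℝ, Model n).tangent
      (tangentMap 𝓘(ℝ, Model n) 𝓘(ℝ, Model n) Φ ∘ (radialSection n ∘ Φ.symm)) (Φ y) :=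
    ((hT.mdifferentiable one_ne_zero) _).comp (Φ y)
      (MDifferentiableAt.comp (Φ y) (by rw [e]; exact hN)
        (Φ.symm.mdifferentiable (by simp) (Φ y)))
  refine hcomp.congr_of_eventuallyEq ?_
  filter_upwards [isOpen_compl_singleton.mem_nhds hx] with z hz
  obtain ⟨w, hw, rfl⟩ := exists_ne_zero_of_ne hz
  have e' : Φ.symm (Φ w) = w := Φ.symm_apply_apply w
  rw [h.riemGradient_dist hw]
  change _ = tangentMap 𝓘(ℝ, Model n) 𝓘(ℝ, Model n) Φ (radialSection n (Φ.symm (Φ w)))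
  rw [e']
  rfl

/-- `Δ(φ ∘ r) = φ'(r) Δr + φ''(r)`, because `|∇r| = 1`. -/
lemma IsPolarChart.laplaceBeltrami_comp_dist (h : IsPolarChart f Φ) (cov : AffineConnection n M)
    {x : M} (hx : x ≠ Φ 0) {φ φ' : ℝ → ℝ} {c : ℝ}
    (hφ : ∀ᶠ t in 𝓝 (dist x (Φ 0)), HasDerivAt φ (φ' t) t)
    (hφ' : HasDerivAt φ' c (dist x (Φ 0))) :
    laplaceBeltrami cov (fun z => φ (dist z (Φ 0))) x =
      φ' (dist x (Φ 0)) * laplaceBeltrami cov (fun z => dist z (Φ 0)) x + c := by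
  set r : M → ℝ := fun z => dist z (Φ 0) with hr
  have hrd : MDifferentiableAt 𝓘(ℝ, Model n) 𝓘(ℝ, ℝ) r x :=
    (h.contMDiffAt_comp_dist (F := fun t => t) (k := 1) hx contDiffAt_id).mdifferentiableAt
      one_ne_zero
  have hcr : ContinuousAt r x := hrd.continuousAt
  have hg := h.mdifferentiableAt_riemGradient_dist hx
  have hφr : MDifferentiableAt 𝓘(ℝ, Model n) 𝓘(ℝ, ℝ) (φ' ∘ r) x :=
    hφ'.differentiableAt.mdifferentiableAt.comp x hrd
  have hev : ∀ᶠ z in 𝓝 x, riemGradient (n := n) (fun z => φ (r z)) z =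
      ((φ' ∘ r) • riemGradient (n := n) r) z := by
    filter_upwards [isOpen_compl_singleton.mem_nhds hx, hcr.eventually hφ] with z hz hz'
    exact h.riemGradient_comp_dist_eq_smul hz hz'
  have hs := MDifferentiableAt.smul_section hφr hg
  have hcov : cov (riemGradient (n := n) (fun z => φ (r z))) x =
      φ' (r x) • cov (riemGradient (n := n) r) x +
        (mvfderiv 𝓘(ℝ, Model n) (φ' ∘ r) x).smulRight (riemGradient (n := n) r x) := by
    rw [cov.isCovariantDerivativeOn.congr_of_eventuallyEq
      (s := univ) (σ' := (φ' ∘ r) • riemGradient (n := n) r) ?_ hs Filter.univ_mem hev]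
    · exact cov.isCovariantDerivativeOnUniv.leibniz hg hφr
    · refine hs.congr_of_eventuallyEq ?_
      filter_upwards [hev] with z hz
      rw [hz]
  -- The second term of `∇(φ'(r) ∇r) = φ'(r) ∇²r + d(φ'(r)) ⊗ ∇r` has trace `φ''(r) |∇r|²`.
  have htr : mvfderiv 𝓘(ℝ, Model n) (φ' ∘ r) x (riemGradient (n := n) r x) = c := by
    have := inner_riemGradient (n := n) (φ' ∘ r) x (riemGradient (n := n) r x)
    rw [← this]
    have h2 : riemGradient (n := n) (φ' ∘ r) x = c • riemGradient (n := n) r x :=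
      h.riemGradient_comp_dist_eq_smul hx hφ'
    rw [h2, real_inner_smul_left, real_inner_self_eq_norm_sq, h.norm_riemGradient_dist hx]
    ring
  unfold laplaceBeltrami
  rw [hcov]
  have hlin : (φ' (r x) • cov (riemGradient (n := n) r) x +
        (mvfderiv 𝓘(ℝ, Model n) (φ' ∘ r) x).smulRight (riemGradient (n := n) r x)).toLinearMap =
      φ' (r x) • (cov (riemGradient (n := n) r) x).toLinearMap +
        (mvfderiv 𝓘(ℝ, Model n) (φ' ∘ r) x).toLinearMap.smulRight (riemGradient (n := n) r x) := rfl
  rw [hlin, map_add, map_smul]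
  have : Module.Finite ℝ (TangentSpace 𝓘(ℝ, Model n) x) :=
    inferInstanceAs (Module.Finite ℝ (Model n))
  have : Module.Free ℝ (TangentSpace 𝓘(ℝ, Model n) x) :=
    inferInstanceAs (Module.Free ℝ (Model n))
  have h3 := LinearMap.trace_smulRight
    (mvfderiv 𝓘(ℝ, Model n) (φ' ∘ r) x).toLinearMap (riemGradient (n := n) r x)
  exact congrArg _ (h3.trans htr)

end Radial

end

/-! ### Failure of the maximum principle -/

noncomputable section

section Tamed

variable {G H : ℝ → ℝ}

lemma IsTamedMinorant.pos (hH : IsTamedMinorant G H) {t : ℝ} (ht : 0 ≤ t) : 0 < H t :=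
  lt_of_lt_of_le (by norm_num) (hH.half_le t ht)

lemma IsTamedMinorant.hasDerivAt (hH : IsTamedMinorant G H) {t : ℝ} (ht : 0 < t) :
    HasDerivAt H (derivWithin H (Ici 0) t) t :=
  ((hH.contDiffOn.differentiableOn one_ne_zero t ht.le).hasDerivWithinAt).hasDerivAt
    (Ici_mem_nhds ht)

lemma IsTamedMinorant.continuousOn_one_div (hH : IsTamedMinorant G H) :
    ContinuousOn (fun t => 1 / H t) (Ici 0) :=
  continuousOn_const.div hH.contDiffOn.continuousOn fun _ ht => (hH.pos ht).ne'

lemma IsTamedMinorant.contDiffAt_one_div (hH : IsTamedMinorant G H) {t : ℝ} (ht : 0 < t) :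
    ContDiffAt ℝ 1 (fun t => 1 / H t) t :=
  contDiffAt_const.div (hH.contDiffOn.contDiffAt (Ici_mem_nhds ht)) (hH.pos ht.le).ne'

lemma IsTamedMinorant.hasDerivAt_one_div (hH : IsTamedMinorant G H) {t : ℝ} (ht : 0 < t) :
    HasDerivAt (fun t => 1 / H t) (-derivWithin H (Ici 0) t / H t ^ 2) t := by
  simp only [one_div]
  exact (hH.hasDerivAt ht).inv (hH.pos ht.le).ne'

lemma IsTamedMinorant.neg_one_le (hH : IsTamedMinorant G H) {t : ℝ} (ht : 0 < t) :
    -1 ≤ -derivWithin H (Ici 0) t / H t ^ 2 := by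
  rw [neg_div, neg_le_neg_iff, div_le_one (pow_pos (hH.pos ht.le) 2)]
  exact hH.deriv_le_sq t ht.le

lemma IsTamedMinorant.intervalIntegrable (hH : IsTamedMinorant G H) {a b : ℝ} (ha : 0 ≤ a)
    (hb : 0 ≤ b) : IntervalIntegrable (fun t => 1 / H t) volume a b :=
  (hH.continuousOn_one_div.mono fun _ ht => (le_inf ha hb).trans ht.1).intervalIntegrable

lemma IsTamedMinorant.hasDerivAt_integral (hH : IsTamedMinorant G H) {t : ℝ} (ht : 0 < t) :
    HasDerivAt (fun s => ∫ τ in (0 : ℝ)..s, 1 / H τ) (1 / H t) t := by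
  have hc : ContinuousAt (fun t => 1 / H t) t := (hH.contDiffAt_one_div ht).continuousAt
  refine intervalIntegral.integral_hasDerivAt_right (hH.intervalIntegrable le_rfl ht.le) ?_ hc
  exact (hH.continuousOn_one_div.mono Ioi_subset_Ici_self).stronglyMeasurableAtFilter
    isOpen_Ioi t ht

lemma IsTamedMinorant.contDiffAt_integral (hH : IsTamedMinorant G H) {t : ℝ} (ht : 0 < t) :
    ContDiffAt ℝ 2 (fun s => ∫ τ in (0 : ℝ)..s, 1 / H τ) t := by
  have h : ContDiffOn ℝ (1 + 1) (fun s => ∫ τ in (0 : ℝ)..s, 1 / H τ) (Ioi 0) := by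
    rw [contDiffOn_succ_iff_deriv_of_isOpen isOpen_Ioi]
    refine ⟨fun s hs => (hH.hasDerivAt_integral hs).differentiableAt.differentiableWithinAt,
      by simp, ?_⟩
    refine ContDiffOn.congr (f := fun t => 1 / H t)
      (fun s hs => (hH.contDiffAt_one_div hs).contDiffWithinAt) ?_
    exact fun s hs => (hH.hasDerivAt_integral hs).deriv
  have := h.contDiffAt (Ioi_mem_nhds ht)
  rwa [one_add_one_eq_two] at this

lemma IsTamedMinorant.integral_nonneg (hH : IsTamedMinorant G H) {t : ℝ} (ht : 0 ≤ t) :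
    0 ≤ ∫ τ in (0 : ℝ)..t, 1 / H τ :=
  intervalIntegral.integral_nonneg ht fun _ hτ => (one_div_pos.mpr (hH.pos hτ.1)).le

lemma IsTamedMinorant.integral_le (hH : IsTamedMinorant G H) {t : ℝ} (ht : 0 ≤ t) :
    ∫ τ in (0 : ℝ)..t, 1 / H τ ≤ ∫ τ in Ici (0 : ℝ), 1 / H τ := by
  rw [intervalIntegral.integral_of_le ht]
  refine setIntegral_mono_set hH.finite_integral ?_
    (Filter.Eventually.of_forall fun _ hτ => hτ.1.le)
  exact (ae_restrict_iff' measurableSet_Ici).mpr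
    (Filter.Eventually.of_forall fun _ hτ => (one_div_pos.mpr (hH.pos hτ)).le)

/-- A smooth step, equal to `0` on `(-∞, 1/2]` and to `1` on `[1, ∞)`. -/
def radialCutoff (t : ℝ) : ℝ := Real.smoothTransition (2 * t - 1)

lemma radialCutoff_of_le {t : ℝ} (ht : t ≤ 1 / 2) : radialCutoff t = 0 :=
  Real.smoothTransition.zero_of_nonpos (by linarith)

lemma radialCutoff_of_one_le {t : ℝ} (ht : 1 ≤ t) : radialCutoff t = 1 :=
  Real.smoothTransition.one_of_one_le (by linarith)

lemma radialCutoff_nonneg (t : ℝ) : 0 ≤ radialCutoff t := Real.smoothTransition.nonneg _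

lemma radialCutoff_le_one (t : ℝ) : radialCutoff t ≤ 1 := Real.smoothTransition.le_one _

lemma contDiff_radialCutoff {k : WithTop ℕ∞} (hk : k ≤ ∞) : ContDiff ℝ k radialCutoff :=
  (Real.smoothTransition.contDiff (n := ⊤)).of_le hk |>.comp
    ((contDiff_const.mul contDiff_id).sub contDiff_const)

/-- Multiplication by the cutoff turns a function that is smooth on `(0, ∞)` into one that is
smooth on `ℝ`. -/
lemma contDiff_radialCutoff_mul {k : WithTop ℕ∞} (hk : k ≤ ∞) {F : ℝ → ℝ}
    (hF : ∀ t, 0 < t → ContDiffAt ℝ k F t) : ContDiff ℝ k fun t => radialCutoff t * F t := by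
  rw [contDiff_iff_contDiffAt]
  intro t
  rcases lt_or_ge 0 t with ht | ht
  · exact (contDiff_radialCutoff hk).contDiffAt.mul (hF t ht)
  · refine (contDiffAt_const (c := (0 : ℝ))).congr_of_eventuallyEq ?_
    filter_upwards [Iio_mem_nhds (show t < 1 / 2 by linarith)] with s hs
    rw [radialCutoff_of_le (le_of_lt hs), zero_mul]

/-- A function of the norm is smooth as soon as it is constant near the origin. -/
lemma contDiff_comp_norm {E : Type*} [NormedAddCommGroup E] [InnerProductSpace ℝ E]
    {k : WithTop ℕ∞} {F : ℝ → ℝ} (hF : ContDiff ℝ k F) {a c : ℝ} (ha : 0 < a)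
    (hc : ∀ t ≤ a, F t = c) : ContDiff ℝ k fun y : E => F ‖y‖ := by
  rw [contDiff_iff_contDiffAt]
  intro y
  rcases eq_or_ne y 0 with rfl | hy
  · refine (contDiffAt_const (c := c)).congr_of_eventuallyEq ?_
    filter_upwards [Metric.ball_mem_nhds (0 : E) ha] with z hz
    exact hc _ (mem_ball_zero_iff.mp hz).le
  · exact ContDiffAt.comp y hF.contDiffAt (contDiffAt_norm ℝ hy)

lemma contDiff_integral_of_contDiff {k : ℕ} {F : ℝ → ℝ} (hF : ContDiff ℝ k F) :
    ContDiff ℝ (k + 1) fun t => ∫ τ in (0 : ℝ)..t, F τ := by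
  have hd : ∀ t, HasDerivAt (fun t => ∫ τ in (0 : ℝ)..t, F τ) (F t) t :=
    fun t => hF.continuous.integral_hasStrictDerivAt 0 t |>.hasDerivAt
  rw [contDiff_succ_iff_deriv]
  refine ⟨fun t => (hd t).differentiableAt, by simp, ?_⟩
  rwa [show deriv (fun t => ∫ τ in (0 : ℝ)..t, F τ) = F from funext fun t => (hd t).deriv]

lemma integral_radialCutoff_mul_of_le (F : ℝ → ℝ) {t : ℝ} (ht : t ≤ 1 / 2) :
    ∫ τ in (0 : ℝ)..t, radialCutoff τ * F τ = 0 := by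
  refine (intervalIntegral.integral_congr (g := fun _ => 0) fun τ hτ => ?_).trans (by simp)
  have : τ ≤ 1 / 2 := hτ.2.trans (max_le (by norm_num) ht)
  simp only [radialCutoff_of_le this, zero_mul]

end Tamed

section Obstruction

variable {n : ℕ} {M : Type*} [MetricSpace M] [ChartedSpace (Model n) M]
  [IsManifold 𝓘(ℝ, Model n) ∞ M]
  [RiemannianBundle (fun x : M => TangentSpace 𝓘(ℝ, Model n) x)]
  [IsRiemannianManifold 𝓘(ℝ, Model n) M]
  {G H f : ℝ → ℝ} {Φ : Diffeomorph 𝓘(ℝ, Model n) 𝓘(ℝ, Model n) (Model n) M ∞}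

/-- If `Δr ≥ 2H(r)` outside the unit ball, the bounded function `∫₀^r χ/H` violates the maximum
principle. The cutoff `χ` makes it `C²` at the pole without changing its derivatives for `r ≥ 1`,
which is where it comes close to its supremum. -/
theorem IsPolarChart.not_omoriYau (h : IsPolarChart f Φ) (hn : 1 ≤ n)
    (cov : AffineConnection n M) (hH : IsTamedMinorant G H)
    (hΔ : ∀ x : M, 1 < dist x (Φ 0) →
      2 * H (dist x (Φ 0)) ≤ laplaceBeltrami cov (fun z => dist z (Φ 0)) x) :
    ¬ OmoriYau cov := by
  intro hOY
  set k : ℝ → ℝ := fun t => radialCutoff t * (1 / H t) with hk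
  set ψ : ℝ → ℝ := fun t => ∫ τ in (0 : ℝ)..t, k τ with hψ
  have hkC : ContDiff ℝ (1 : ℕ) k :=
    contDiff_radialCutoff_mul (by norm_cast)
      fun t ht => by exact_mod_cast hH.contDiffAt_one_div ht
  have hψC : ContDiff ℝ 2 ψ := by
    have := contDiff_integral_of_contDiff hkC
    norm_num at this
    exact this
  have hψd : ∀ t, HasDerivAt ψ (k t) t :=
    fun t => (hkC.continuous.integral_hasStrictDerivAt 0 t).hasDerivAt
  have hk0 : ∀ t, 0 ≤ k t := by
    intro t
    rcases le_total 0 t with ht | ht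
    · exact mul_nonneg (radialCutoff_nonneg t) (one_div_pos.mpr (hH.pos ht)).le
    · rw [hk]
      simp only [radialCutoff_of_le (show t ≤ 1 / 2 by linarith), zero_mul, le_refl]
  have hmono : Monotone ψ :=
    monotone_of_deriv_nonneg (fun t => (hψd t).differentiableAt) fun t => by
      rw [(hψd t).deriv]; exact hk0 t
  have hψ12 : ψ 1 < ψ 2 := by
    have hs : StrictMonoOn ψ (Icc 1 2) := by
      refine strictMonoOn_of_deriv_pos (convex_Icc 1 2) hψC.continuous.continuousOn fun t ht => ?_
      rw [interior_Icc] at ht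
      rw [(hψd t).deriv, hk]
      simp only [radialCutoff_of_one_le ht.1.le, one_mul]
      exact one_div_pos.mpr (hH.pos (zero_le_one.trans ht.1.le))
    exact hs (left_mem_Icc.mpr one_le_two) (right_mem_Icc.mpr one_le_two) one_lt_two
  have hbound : ∀ t, 0 ≤ t → ψ t ≤ ∫ τ in Ici (0 : ℝ), 1 / H τ := by
    intro t ht
    refine le_trans (intervalIntegral.integral_mono_on ht
      (hkC.continuous.intervalIntegrable 0 t) (hH.intervalIntegrable le_rfl ht) fun _ hτ => ?_)
      (hH.integral_le ht)
    exact mul_le_of_le_one_left (one_div_pos.mpr (hH.pos hτ.1)).le (radialCutoff_le_one _)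
  set g : M → ℝ := fun x => ψ (dist x (Φ 0)) with hg
  have hgC : ContMDiff 𝓘(ℝ, Model n) 𝓘(ℝ, ℝ) 2 g := by
    rw [hg, h.comp_dist_eq ψ]
    have h1 : ContDiff ℝ 2 (fun y : Model n => ψ ‖y‖) :=
      contDiff_comp_norm hψC (a := 1 / 2) (c := 0) (by norm_num)
        fun t ht => integral_radialCutoff_mul_of_le _ ht
    exact h1.contMDiff.comp (Φ.symm.contMDiff.of_le (by norm_cast))
  have hgB : BddAbove (range g) := by
    refine ⟨∫ τ in Ici (0 : ℝ), 1 / H τ, ?_⟩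
    rintro _ ⟨x, rfl⟩
    exact hbound _ dist_nonneg
  have hsup : ψ 2 ≤ sSup (range g) := by
    have : Nonempty (Fin n) := ⟨⟨0, hn⟩⟩
    obtain ⟨y, hy⟩ := exists_norm_eq (Model n) (show (0 : ℝ) ≤ 2 by norm_num)
    refine le_csSup hgB ⟨Φ y, ?_⟩
    rw [hg]
    simp only [h.dist_eq_norm, hy]
  -- Points where `g` is within `ψ 2 - ψ 1` of its supremum lie outside the unit ball.
  obtain ⟨x, hx1, -, hx3⟩ := hOY g hgC hgB (min 1 (ψ 2 - ψ 1))
    (lt_min one_pos (sub_pos.mpr hψ12))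
  have hx : 1 < dist x (Φ 0) := by
    by_contra hcon
    have h1 : g x ≤ ψ 1 := hmono (not_lt.mp hcon)
    have h2 := (abs_lt.mp hx1).1
    have h3 := min_le_right 1 (ψ 2 - ψ 1)
    linarith
  have hr0 : 0 < dist x (Φ 0) := one_pos.trans hx
  have hkd : HasDerivAt k (-derivWithin H (Ici 0) (dist x (Φ 0)) / H (dist x (Φ 0)) ^ 2)
      (dist x (Φ 0)) := by
    refine (hH.hasDerivAt_one_div hr0).congr_of_eventuallyEq ?_
    filter_upwards [Ioi_mem_nhds hx] with t ht
    simp only [hk, radialCutoff_of_one_le (le_of_lt ht), one_mul]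
  have hL := h.laplaceBeltrami_comp_dist cov (dist_pos.mp hr0)
    (Filter.Eventually.of_forall hψd) hkd
  have hkx : k (dist x (Φ 0)) = 1 / H (dist x (Φ 0)) := by
    simp only [hk, radialCutoff_of_one_le hx.le, one_mul]
  have hHx := hH.pos hr0.le
  have h2 : 2 ≤ 1 / H (dist x (Φ 0)) * laplaceBeltrami cov (fun z => dist z (Φ 0)) x := by
    rw [one_div_mul_eq_div, le_div_iff₀ hHx]
    exact hΔ x hx
  have h1 := hH.neg_one_le hr0
  rw [hkx] at hL
  have := lt_of_lt_of_le hx3 (min_le_left _ _)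
  rw [hg, hL] at this
  linarith

end Obstruction

section Rotational

variable {n : ℕ} {M : Type*} [MetricSpace M] [ChartedSpace (Model n) M]
  [IsManifold 𝓘(ℝ, Model n) ∞ M]
  [RiemannianBundle (fun x : M => TangentSpace 𝓘(ℝ, Model n) x)]
  [IsRiemannianManifold 𝓘(ℝ, Model n) M]

/-- The integral `h = ∫₀^r dt/H` is bounded, `C²` away from the pole, and `Δh > 1` there, because
`Δh = Δr / H - H' / H²` with `Δr > G ≥ 2H` and `H' ≤ H²`. -/
theorem IsPolarChart.integral_comp_dist {G H f : ℝ → ℝ}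
    {Φ : Diffeomorph 𝓘(ℝ, Model n) 𝓘(ℝ, Model n) (Model n) M ∞} (h : IsPolarChart f Φ)
    (cov : AffineConnection n M)
    (hΔ : ∀ x : M, x ≠ Φ 0 →
      G (dist x (Φ 0)) < laplaceBeltrami cov (fun z => dist z (Φ 0)) x)
    (hH : IsTamedMinorant G H) {w : M → ℝ}
    (hw : ∀ x, w x = ∫ t in (0 : ℝ)..dist x (Φ 0), 1 / H t) :
    (∃ C : ℝ, ∀ x, |w x| ≤ C) ∧
      ContMDiffOn 𝓘(ℝ, Model n) 𝓘(ℝ, ℝ) 2 w {Φ 0}ᶜ ∧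
      ∀ x : M, x ≠ Φ 0 → 1 < laplaceBeltrami cov w x := by
  obtain rfl : w = fun x => (fun s => ∫ t in (0 : ℝ)..s, 1 / H t) (dist x (Φ 0)) := funext hw
  refine ⟨⟨∫ τ in Ici (0 : ℝ), 1 / H τ, fun x => ?_⟩, fun x hx => ?_, fun x hx => ?_⟩
  · rw [abs_of_nonneg (hH.integral_nonneg dist_nonneg)]
    exact hH.integral_le dist_nonneg
  · exact (h.contMDiffAt_comp_dist (k := 2) hx
      (hH.contDiffAt_integral (dist_pos.mpr hx))).contMDiffWithinAt
  · have hr0 : 0 < dist x (Φ 0) := dist_pos.mpr hx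
    have hev : ∀ᶠ t in 𝓝 (dist x (Φ 0)),
        HasDerivAt (fun s => ∫ τ in (0 : ℝ)..s, 1 / H τ) (1 / H t) t := by
      filter_upwards [Ioi_mem_nhds hr0] with t ht using hH.hasDerivAt_integral ht
    rw [h.laplaceBeltrami_comp_dist cov hx hev (hH.hasDerivAt_one_div hr0)]
    have h2 : 2 < 1 / H (dist x (Φ 0)) * laplaceBeltrami cov (fun z => dist z (Φ 0)) x := by
      rw [one_div_mul_eq_div, lt_div_iff₀ (hH.pos hr0.le)]
      exact (hH.two_mul_le _ hr0.le).trans_lt (hΔ x hx)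
    linarith [hH.neg_one_le hr0]

end Rotational

end

/-! ### Christoffel symbols of a metric on a vector space -/

noncomputable section

-- Instance search on iterated spaces of continuous linear maps is deep, and slow when the fibrewise
-- instances of Riemannian bundles are in scope.
set_option maxSynthPendingDepth 3
set_option synthInstance.maxHeartbeats 200000
set_option maxHeartbeats 1000000

section Koszul

variable {E : Type*} [NormedAddCommGroup E] [InnerProductSpace ℝ E] [FiniteDimensional ℝ E]

/-- Christoffel symbols at a point, from the metric `g₀` and its derivative `D` at that point:
`D z u v` stands for the derivative in the direction `z` of `g(u, v)`, and `Γ w v` for the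
correction term in `∇_v w`. -/
def IsChristoffel (g₀ : E →L[ℝ] E →L[ℝ] ℝ) (D : E →L[ℝ] E →L[ℝ] E →L[ℝ] ℝ)
    (Γ : E →L[ℝ] E →L[ℝ] E) : Prop :=
  ∀ w v z, g₀ (Γ w v) z = (D v w z + D w v z - D z v w) / 2

/-- Existence of Christoffel symbols: raise the last index in the Koszul formula with the
nondegenerate form `g₀`. -/
lemma exists_isChristoffel {g₀ : E →L[ℝ] E →L[ℝ] ℝ} (hpos : ∀ v, v ≠ 0 → 0 < g₀ v v)
    (D : E →L[ℝ] E →L[ℝ] E →L[ℝ] ℝ) : ∃ Γ : E →L[ℝ] E →L[ℝ] E, IsChristoffel g₀ D Γ := by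
  have hc : CompleteSpace E := FiniteDimensional.complete ℝ E
  -- `T` represents `g₀` in the ambient inner product, `g₀ u v = ⟪T u, v⟫`.
  let T : E →ₗ[ℝ] E := (InnerProductSpace.toDual ℝ E).symm.toLinearEquiv.toLinearMap.comp
    g₀.toLinearMap
  have hT : Function.Injective T := by
    rw [← LinearMap.ker_eq_bot, LinearMap.ker_eq_bot']
    intro v hv
    by_contra h0
    have h1 : g₀ v = 0 := by
      simpa [T] using hv
    have := hpos v h0
    rw [h1] at this
    exact lt_irrefl _ this
  let e := LinearEquiv.ofInjectiveEndo T hT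
  have he : ∀ a z, g₀ (e.symm a) z = inner ℝ a z := by
    intro a z
    have h1 : T (e.symm a) = a := e.apply_symm_apply a
    have h2 : inner ℝ (T (e.symm a)) z = g₀ (e.symm a) z :=
      InnerProductSpace.toDual_symm_apply
    rw [← h2, h1]
  let K : E → E → E →L[ℝ] ℝ := fun w v => (1 / 2 : ℝ) • (D v w + D w v - (D.flip v).flip w)
  let B : E →ₗ[ℝ] E →ₗ[ℝ] E := LinearMap.mk₂ ℝ
    (fun w v => e.symm ((InnerProductSpace.toDual ℝ E).symm (K w v)))
    (fun w w' v => by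
      rw [← map_add, ← map_add]; congr 2; ext z; simp [K]; ring)
    (fun c w v => by
      rw [← map_smul, ← LinearIsometryEquiv.map_smul]; congr 2; ext z; simp [K]; ring)
    (fun w v v' => by
      rw [← map_add, ← map_add]; congr 2; ext z; simp [K]; ring)
    (fun c w v => by
      rw [← map_smul, ← LinearIsometryEquiv.map_smul]; congr 2; ext z; simp [K]; ring)
  refine ⟨B.toContinuousBilinearMap, fun w v z => ?_⟩
  rw [LinearMap.toContinuousBilinearMap_apply]
  simp only [B, LinearMap.mk₂_apply]
  rw [he, InnerProductSpace.toDual_symm_apply]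
  simp [K]
  ring

variable {g₀ : E →L[ℝ] E →L[ℝ] ℝ} {D : E →L[ℝ] E →L[ℝ] E →L[ℝ] ℝ} {Γ : E →L[ℝ] E →L[ℝ] E}

omit [FiniteDimensional ℝ E] in
lemma eq_of_forall_metric_eq (hpos : ∀ v, v ≠ 0 → 0 < g₀ v v) {a b : E}
    (h : ∀ z, g₀ a z = g₀ b z) : a = b := by
  by_contra hne
  have := hpos (a - b) (sub_ne_zero.mpr hne)
  have e : g₀ (a - b) = 0 := by ext z; rw [map_sub, sub_apply, h z, sub_self]; rfl
  rw [e] at this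
  exact lt_irrefl _ this

omit [FiniteDimensional ℝ E] in
lemma IsChristoffel.symm (hΓ : IsChristoffel g₀ D Γ) (hpos : ∀ v, v ≠ 0 → 0 < g₀ v v)
    (hD : ∀ z u v, D z u v = D z v u) (v w : E) : Γ w v = Γ v w := by
  refine eq_of_forall_metric_eq hpos fun z => ?_
  rw [hΓ w v z, hΓ v w z, hD z v w]
  ring

omit [FiniteDimensional ℝ E] in
lemma IsChristoffel.add_eq (hΓ : IsChristoffel g₀ D Γ) (hsymm : ∀ u v, g₀ u v = g₀ v u)
    (hD : ∀ z u v, D z u v = D z v u) (v s t : E) :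
    g₀ (Γ s v) t + g₀ s (Γ t v) = D v s t := by
  rw [hsymm s, hΓ s v t, hΓ t v s, hD v t s, hD t v s, hD s v t]
  ring

end Koszul

/-! ### Rotationally symmetric metrics on a vector space -/

section Warped

variable {E : Type*} [NormedAddCommGroup E] [InnerProductSpace ℝ E]

/-- The exponent `Q` of a warping function `f(r) = r exp(Q(r))`. It vanishes near the pole, where
the metric is therefore Euclidean and smooth. -/
structure WarpExponent where
  /-- The underlying function. -/
  toFun : ℝ → ℝ
  contDiff : ContDiff ℝ ∞ toFun
  eq_zero : ∀ t ≤ 1 / 2, toFun t = 0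

variable (Q : WarpExponent)

/-- The metric `dr² + f(r)² dθ²` with `f(r) = r exp(Q(r))`, written as
`α(r) ⟪u, v⟫ + r⁻² (1 - α(r)) ⟪y, u⟫ ⟪y, v⟫` with `α = exp(2 Q)`. The division by zero at `y = 0` is
harmless, since `1 - α` vanishes near the origin. -/
def warpedForm (y : E) : E →L[ℝ] E →L[ℝ] ℝ :=
  letI g : E →L[ℝ] E →L[ℝ] ℝ := innerSL ℝ
  Real.exp (2 * Q.toFun ‖y‖) • g +
    ((1 - Real.exp (2 * Q.toFun ‖y‖)) / ‖y‖ ^ 2) • (innerSL ℝ y).smulRight (innerSL ℝ y)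

lemma warpedForm_apply (y u v : E) : warpedForm Q y u v =
    Real.exp (2 * Q.toFun ‖y‖) * inner ℝ u v +
      (1 - Real.exp (2 * Q.toFun ‖y‖)) / ‖y‖ ^ 2 * (inner ℝ y u * inner ℝ y v) := by
  rfl

lemma contDiff_warpedForm : ContDiff ℝ ∞ (warpedForm Q : E → E →L[ℝ] E →L[ℝ] ℝ) := by
  have h1 : ContDiff ℝ ∞ fun t => Real.exp (2 * Q.toFun t) :=
    (contDiff_const.mul Q.contDiff).exp
  have h2 : ContDiff ℝ ∞ fun t => (1 - Real.exp (2 * Q.toFun t)) / t ^ 2 := by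
    rw [contDiff_iff_contDiffAt]
    intro t
    rcases eq_or_ne t 0 with rfl | ht
    · refine (contDiffAt_const (c := (0 : ℝ))).congr_of_eventuallyEq ?_
      filter_upwards [Iio_mem_nhds (show (0 : ℝ) < 1 / 2 by norm_num)] with s hs
      simp [Q.eq_zero s (le_of_lt hs)]
    · exact (contDiffAt_const.sub h1.contDiffAt).div (contDiffAt_id.pow 2) (pow_ne_zero 2 ht)
  have h3 : ContDiff ℝ ∞ fun y : E => Real.exp (2 * Q.toFun ‖y‖) :=
    contDiff_comp_norm h1 (a := 1 / 2) (c := 1) (by norm_num) fun t ht => by simp [Q.eq_zero t ht]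
  have h4 : ContDiff ℝ ∞ fun y : E => (1 - Real.exp (2 * Q.toFun ‖y‖)) / ‖y‖ ^ 2 :=
    contDiff_comp_norm h2 (a := 1 / 2) (c := 0) (by norm_num) fun t ht => by simp [Q.eq_zero t ht]
  have h5 : ContDiff ℝ ∞ fun y : E => (innerSL ℝ y).smulRight (innerSL ℝ y) :=
    (innerSL ℝ (E := E)).contDiff.smulRight (innerSL ℝ (E := E)).contDiff
  exact (h3.smul contDiff_const).add (h4.smul h5)

lemma warpedForm_symm (y u v : E) : warpedForm Q y u v = warpedForm Q y v u := by
  rw [warpedForm_apply, warpedForm_apply, real_inner_comm u v]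
  ring

lemma warpedForm_polar {y : E} (hy : y ≠ 0) (u v : E) : warpedForm Q y u v =
    (inner ℝ u y / ‖y‖) * (inner ℝ v y / ‖y‖) + (‖y‖ * Real.exp (Q.toFun ‖y‖)) ^ 2 *
      ((inner ℝ u v - (inner ℝ u y / ‖y‖) * (inner ℝ v y / ‖y‖)) / ‖y‖ ^ 2) := by
  have hy' : ‖y‖ ≠ 0 := norm_ne_zero_iff.mpr hy
  rw [warpedForm_apply, mul_pow, ← Real.exp_nat_mul, real_inner_comm u y, real_inner_comm v y]
  push_cast
  field_simp
  ring

/-- The metric is bounded below by the smaller of `1` and `α` times the Euclidean one. -/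
lemma le_warpedForm (y v : E) :
    min 1 (Real.exp (2 * Q.toFun ‖y‖)) * ‖v‖ ^ 2 ≤ warpedForm Q y v v := by
  set α := Real.exp (2 * Q.toFun ‖y‖) with hα
  rcases eq_or_ne y 0 with rfl | hy
  · rw [warpedForm_apply]
    simpa [Q.eq_zero 0 (by norm_num)] using
      mul_le_of_le_one_left (sq_nonneg ‖v‖) (min_le_left 1 α)
  have hy' : 0 < ‖y‖ := norm_pos_iff.mpr hy
  set d := (inner ℝ v y / ‖y‖) * (inner ℝ v y / ‖y‖) with hd
  have hd0 : 0 ≤ d := mul_self_nonneg _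
  have hd1 : d ≤ ‖v‖ ^ 2 := by
    rw [hd, div_mul_div_comm, div_le_iff₀ (by positivity), ← real_inner_self_eq_norm_sq,
      ← real_inner_self_eq_norm_mul_norm]
    exact real_inner_mul_inner_self_le v y
  have e : warpedForm Q y v v = d + α * (‖v‖ ^ 2 - d) := by
    rw [warpedForm_apply, hd, real_inner_comm v y, real_inner_self_eq_norm_sq, ← hα]
    field_simp
    ring
  rw [e]
  have h1 := mul_le_mul_of_nonneg_right (min_le_left 1 α) hd0
  have h2 := mul_le_mul_of_nonneg_right (min_le_right 1 α) (sub_nonneg.mpr hd1)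
  linarith

lemma warpedForm_pos (y v : E) (hv : v ≠ 0) : 0 < warpedForm Q y v v := by
  refine lt_of_lt_of_le ?_ (le_warpedForm Q y v)
  have : 0 < ‖v‖ := norm_pos_iff.mpr hv
  positivity

lemma fderiv_warpedForm_symm (y z u v : E) :
    fderiv ℝ (warpedForm Q) y z u v = fderiv ℝ (warpedForm Q) y z v u := by
  have hd := ((contDiff_warpedForm Q (E := E)).differentiable (by simp) y).hasFDerivAt
  have h : ∀ u v : E, HasFDerivAt (fun y => warpedForm Q y u v)
      (((fderiv ℝ (warpedForm Q) y).flip u).flip v) y := fun u v =>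
    ((hd.clm_apply (hasFDerivAt_const u y)).clm_apply (hasFDerivAt_const v y)).congr_fderiv (by
      ext z; simp)
  have h1 := (h u v).unique ((h v u).congr_of_eventuallyEq
    (Filter.Eventually.of_forall fun y => warpedForm_symm Q y u v))
  exact congrArg (fun L => L z) h1

lemma exists_isChristoffel_warpedForm [FiniteDimensional ℝ E] :
    ∃ Γ : E → E →L[ℝ] E →L[ℝ] E,
      ∀ y, IsChristoffel (warpedForm Q y) (fderiv ℝ (warpedForm Q) y) (Γ y) := by
  choose Γ hΓ using fun y : E =>
    exists_isChristoffel (warpedForm_pos Q y) (fderiv ℝ (warpedForm Q) y)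
  exact ⟨Γ, hΓ⟩

/-- The Euclidean projection of `v` onto the orthogonal complement of `y`. -/
def tangentialPart (y v : E) : E := v - inner ℝ v (‖y‖⁻¹ • y) • (‖y‖⁻¹ • y)

variable {Q}

lemma warpedForm_radial {y : E} (hy : y ≠ 0) (z : E) :
    warpedForm Q y (‖y‖⁻¹ • y) z = inner ℝ (‖y‖⁻¹ • y) z := by
  have hy' : ‖y‖ ≠ 0 := norm_ne_zero_iff.mpr hy
  rw [warpedForm_apply, real_inner_smul_left, real_inner_smul_right, real_inner_self_eq_norm_sq]
  field_simp
  ring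

lemma inner_tangentialPart {y : E} (hy : y ≠ 0) (v : E) : inner ℝ y (tangentialPart y v) = 0 := by
  have hy' : ‖y‖ ≠ 0 := norm_ne_zero_iff.mpr hy
  rw [tangentialPart, inner_sub_right, real_inner_smul_right, real_inner_smul_right,
    real_inner_smul_right, real_inner_self_eq_norm_sq, real_inner_comm v y]
  field_simp
  ring

lemma warpedForm_tangentialPart {y : E} (hy : y ≠ 0) (v z : E) :
    warpedForm Q y (tangentialPart y v) z =
      Real.exp (2 * Q.toFun ‖y‖) * inner ℝ (tangentialPart y v) z := by
  rw [warpedForm_apply, inner_tangentialPart hy]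
  ring

lemma inner_tangentialPart_symm (y v z : E) :
    inner ℝ (tangentialPart y v) z = inner ℝ (tangentialPart y z) v := by
  simp only [tangentialPart, inner_sub_left, real_inner_smul_left, real_inner_smul_right]
  rw [real_inner_comm v z, real_inner_comm y v, real_inner_comm y z]
  ring

lemma hasFDerivAt_radial {y : E} (hy : y ≠ 0) :
    ∃ L : E →L[ℝ] E, HasFDerivAt (fun z : E => ‖z‖⁻¹ • z) L y ∧
      ∀ v, L v = ‖y‖⁻¹ • tangentialPart y v := by
  have hy' : ‖y‖ ≠ 0 := norm_ne_zero_iff.mpr hy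
  have h1 := (hasFDerivAt_comp_norm hy (hasDerivAt_inv hy')).smul (hasFDerivAt_id y)
  refine ⟨_, h1, fun v => ?_⟩
  simp only [add_apply, smul_apply, ContinuousLinearMap.smulRight_apply,
    ContinuousLinearMap.id_apply, innerSL_apply_apply, smul_eq_mul, tangentialPart, id]
  rw [real_inner_smul_right, real_inner_comm v y, smul_sub, smul_smul, smul_smul, sub_eq_add_neg,
    ← neg_smul]
  congr 2
  field_simp

/-- The derivative of the metric in the radial direction, from its polar form along the ray. -/
lemma fderiv_warpedForm_radial {y : E} (hy : y ≠ 0) (v z : E) :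
    fderiv ℝ (warpedForm Q) y (‖y‖⁻¹ • y) v z =
      2 * deriv Q.toFun ‖y‖ * warpedForm Q y (tangentialPart y v) z := by
  have hy' : 0 < ‖y‖ := norm_pos_iff.mpr hy
  obtain ⟨N, hN⟩ : ∃ N : E, N = ‖y‖⁻¹ • y := ⟨_, rfl⟩
  rw [← hN]
  have hNn : ‖N‖ = 1 := by rw [hN, norm_smul, norm_inv, norm_norm, inv_mul_cancel₀ hy'.ne']
  have hyN : ‖y‖ • N = y := by rw [hN, smul_smul, mul_inv_cancel₀ hy'.ne', one_smul]
  have hd : HasFDerivAt (warpedForm Q) (fderiv ℝ (warpedForm Q) y) (‖y‖ • N) := by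
    rw [hyN]
    exact ((contDiff_warpedForm Q (E := E)).differentiable (by simp) y).hasFDerivAt
  have h1 : HasDerivAt (fun t : ℝ => warpedForm Q (t • N) v z)
      (fderiv ℝ (warpedForm Q) y N v z) ‖y‖ := by
    have hray : HasDerivAt (fun t : ℝ => t • N) N ‖y‖ := by
      simpa using (hasDerivAt_id ‖y‖).smul_const N
    have := ((hd.comp_hasDerivAt ‖y‖ hray).clm_apply (hasDerivAt_const ‖y‖ v)).clm_apply
      (hasDerivAt_const ‖y‖ z)
    simpa using this
  have hQ : HasDerivAt Q.toFun (deriv Q.toFun ‖y‖) ‖y‖ :=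
    (Q.contDiff.differentiable (by simp) _).hasDerivAt
  have h2 : HasDerivAt (fun t : ℝ => inner ℝ v N * inner ℝ z N +
      Real.exp (2 * Q.toFun t) * (inner ℝ v z - inner ℝ v N * inner ℝ z N))
      (Real.exp (2 * Q.toFun ‖y‖) * (2 * deriv Q.toFun ‖y‖) *
        (inner ℝ v z - inner ℝ v N * inner ℝ z N)) ‖y‖ :=
    (((hQ.const_mul 2).exp).mul_const _).const_add _
  have hev : (fun t : ℝ => warpedForm Q (t • N) v z) =ᶠ[𝓝 ‖y‖]
      fun t : ℝ => inner ℝ v N * inner ℝ z N +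
        Real.exp (2 * Q.toFun t) * (inner ℝ v z - inner ℝ v N * inner ℝ z N) := by
    filter_upwards [Ioi_mem_nhds hy'] with t ht
    have ht' : (0 : ℝ) < t := ht
    rw [warpedForm_apply, norm_smul, hNn, mul_one, Real.norm_of_nonneg ht'.le,
      real_inner_smul_left, real_inner_smul_left, real_inner_comm v N, real_inner_comm z N]
    field_simp
    ring
  rw [h1.unique (h2.congr_of_eventuallyEq hev), warpedForm_tangentialPart hy, tangentialPart,
    inner_sub_left, real_inner_smul_left, ← hN, real_inner_comm z N]
  ring

/-- `D_v g (N, z)` for the radial field `N`, from differentiating `g(N, z) = ⟪N, z⟫`; it is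
symmetric in `v` and `z`. -/
lemma fderiv_warpedForm_apply_radial {y : E} (hy : y ≠ 0) (v z : E) :
    fderiv ℝ (warpedForm Q) y v (‖y‖⁻¹ • y) z =
      ‖y‖⁻¹ * (1 - Real.exp (2 * Q.toFun ‖y‖)) * inner ℝ (tangentialPart y v) z := by
  obtain ⟨L, hL, hLv⟩ := hasFDerivAt_radial hy
  have hd := ((contDiff_warpedForm Q (E := E)).differentiable (by simp) y).hasFDerivAt
  have h1 := (hd.clm_apply hL).clm_apply (hasFDerivAt_const z y)
  have h2 : HasFDerivAt (fun x : E => inner ℝ (‖x‖⁻¹ • x) z)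
      ((innerSL ℝ z).comp L) y := by
    have := (innerSL ℝ z).hasFDerivAt.comp y hL
    refine this.congr_of_eventuallyEq (Filter.Eventually.of_forall fun x => ?_)
    exact real_inner_comm _ _
  have hev : (fun x : E => warpedForm Q x (‖x‖⁻¹ • x) z) =ᶠ[𝓝 y]
      fun x : E => inner ℝ (‖x‖⁻¹ • x) z := by
    filter_upwards [isOpen_compl_singleton.mem_nhds hy] with x hx
    exact warpedForm_radial hx z
  have h3 := congrArg (fun A => A v) (h1.unique (h2.congr_of_eventuallyEq hev))
  simp only [add_apply, ContinuousLinearMap.comp_apply, ContinuousLinearMap.flip_apply,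
    zero_apply, map_zero, zero_add, innerSL_apply_apply, hLv, map_smul, smul_apply,
    smul_eq_mul] at h3
  rw [warpedForm_tangentialPart hy, real_inner_comm _ z] at h3
  rw [map_smul, smul_apply, smul_eq_mul]
  linarith

/-- `∇_v N = (f'/f) P v` for the radial field `N` and the projection `P` onto its orthogonal
complement, where `f'/f = 1/r + Q'(r)`. -/
lemma radial_covariant_derivative {y : E} (hy : y ≠ 0) {Γ : E →L[ℝ] E →L[ℝ] E}
    (hΓ : IsChristoffel (warpedForm Q y) (fderiv ℝ (warpedForm Q) y) Γ) (v : E) :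
    fderiv ℝ (fun z : E => ‖z‖⁻¹ • z) y v + Γ (‖y‖⁻¹ • y) v =
      (‖y‖⁻¹ + deriv Q.toFun ‖y‖) • tangentialPart y v := by
  obtain ⟨L, hL, hLv⟩ := hasFDerivAt_radial hy
  rw [hL.fderiv, hLv, add_smul]
  congr 1
  refine eq_of_forall_metric_eq (warpedForm_pos Q y) fun z => ?_
  rw [hΓ, fderiv_warpedForm_apply_radial hy, fderiv_warpedForm_radial hy,
    fderiv_warpedForm_symm, fderiv_warpedForm_apply_radial hy, inner_tangentialPart_symm y z v,
    map_smul, smul_apply, smul_eq_mul]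
  ring

lemma trace_tangentialPart [FiniteDimensional ℝ E] {y : E} (hy : y ≠ 0) (c : ℝ) {T : E →ₗ[ℝ] E}
    (hT : ∀ v, T v = c • tangentialPart y v) :
    LinearMap.trace ℝ E T = c * (Module.finrank ℝ E - 1) := by
  have hy' : ‖y‖ ≠ 0 := norm_ne_zero_iff.mpr hy
  have e : T = c • (LinearMap.id -
      (innerSL ℝ (‖y‖⁻¹ • y)).toLinearMap.smulRight (‖y‖⁻¹ • y)) := by
    ext v
    rw [hT, tangentialPart, real_inner_comm]
    rfl
  rw [e, map_smul, map_sub, LinearMap.trace_id, LinearMap.trace_smulRight, smul_eq_mul]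
  congr 2
  change inner ℝ (‖y‖⁻¹ • y) (‖y‖⁻¹ • y) = (1 : ℝ)
  rw [real_inner_smul_left, real_inner_smul_right, real_inner_self_eq_norm_sq]
  field_simp

end Warped

end

/-! ### The warped space as a Riemannian manifold -/

noncomputable section

section WarpedSpace

/-- The points at finite distance from `x` form an open and closed set. -/
lemma edist_ne_top_of_preconnectedSpace {X : Type*} [PseudoEMetricSpace X] [PreconnectedSpace X]
    (x y : X) : edist x y ≠ ⊤ := by
  have hclopen : IsClopen (Metric.eball x ⊤) := ⟨Metric.isClosed_eball_top, Metric.isOpen_eball⟩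
  have huniv : Metric.eball x ⊤ = univ :=
    hclopen.eq_univ ⟨x, Metric.mem_eball_self ENNReal.zero_lt_top⟩
  have hy : y ∈ Metric.eball x ⊤ := huniv ▸ mem_univ y
  rw [edist_comm]
  exact (Metric.mem_eball.mp hy).ne

variable (n : ℕ) (Q : WarpExponent)

/-- The warped metric at `y`, on the tangent space at `y`. -/
def warpedTensor (y : Model n) : TangentSpace 𝓘(ℝ, Model n) y →L[ℝ]
    TangentSpace 𝓘(ℝ, Model n) y →L[ℝ] ℝ :=
  (warpedForm Q (E := Model n) y : Model n →L[ℝ] Model n →L[ℝ] ℝ)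

lemma contMDiff_warpedTensor : ContMDiff 𝓘(ℝ, Model n)
    (𝓘(ℝ, Model n).prod 𝓘(ℝ, Model n →L[ℝ] Model n →L[ℝ] ℝ)) ∞
    (fun y : Model n => TotalSpace.mk' (Model n →L[ℝ] Model n →L[ℝ] ℝ)
      (E := fun x : Model n => TangentSpace 𝓘(ℝ, Model n) x →L[ℝ]
        TangentSpace 𝓘(ℝ, Model n) x →L[ℝ] ℝ) y (warpedTensor n Q y)) := by
  intro x
  rw [contMDiffAt_section]
  have h := (contDiff_warpedForm Q (E := Model n)).contMDiff.contMDiffAt (x := x)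
  refine h.congr_of_eventuallyEq (Filter.Eventually.of_forall fun y => ?_)
  -- The preferred trivializations of the tangent bundle of a vector space are the identity.
  refine ContinuousLinearMap.ext fun v => ContinuousLinearMap.ext fun w => ?_
  dsimp only
  simp [hom_trivializationAt_apply, ContinuousLinearMap.inCoordinates]
  have hmem : y ∈ (trivializationAt (Model n →L[ℝ] ℝ)
      (fun x : Model n => TangentSpace 𝓘(ℝ, Model n) x →L[ℝ] ℝ) x).baseSet := by
    rw [hom_trivializationAt_baseSet]
    simp [chartAt_self_eq]
  rw [Trivialization.linearMapAt_apply, if_pos hmem]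
  change ((trivializationAt (Model n →L[ℝ] ℝ)
      (fun x : Model n => TangentSpace 𝓘(ℝ, Model n) x →L[ℝ] ℝ) x)
      ⟨y, warpedTensor n Q y v⟩).2 w = _
  rw [hom_trivializationAt_apply]
  simp [ContinuousLinearMap.inCoordinates]
  rfl

/-- The warped metric as a Riemannian metric on the tangent bundle of `ℝⁿ`. -/
def warpedRiemannianMetric : ContMDiffRiemannianMetric 𝓘(ℝ, Model n) ∞ (Model n)
    (fun x : Model n => TangentSpace 𝓘(ℝ, Model n) x) where
  inner := warpedTensor n Q
  symm y u v := warpedForm_symm Q (E := Model n) y u v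
  pos y v hv := warpedForm_pos Q (E := Model n) y v hv
  isVonNBounded y := by
    change Bornology.IsVonNBounded ℝ {v : Model n | warpedForm Q y v v < 1}
    set c := min 1 (Real.exp (2 * Q.toFun ‖y‖)) with hc
    have hc0 : 0 < c := lt_min one_pos (Real.exp_pos _)
    refine (NormedSpace.isVonNBounded_closedBall ℝ (Model n) (Real.sqrt (1 / c))).subset
      fun v hv => ?_
    rw [mem_closedBall_zero_iff]
    refine Real.le_sqrt_of_sq_le ?_
    rw [le_div_iff₀' hc0]
    exact (le_warpedForm Q y v).trans (le_of_lt hv)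
  contMDiff := contMDiff_warpedTensor n Q

/-- The distance on `ℝⁿ` induced by the warped metric; it is finite because `ℝⁿ` is connected. -/
@[reducible] def warpedMetricSpace : MetricSpace (Model n) :=
  letI : RiemannianBundle (fun x : Model n => TangentSpace 𝓘(ℝ, Model n) x) :=
    ⟨(warpedRiemannianMetric n Q).toRiemannianMetric⟩
  haveI : IsContinuousRiemannianBundle (Model n)
      (fun x : Model n => TangentSpace 𝓘(ℝ, Model n) x) :=
    ⟨(warpedRiemannianMetric n Q).inner, (warpedRiemannianMetric n Q).contMDiff.continuous,
      fun _ _ _ => rfl⟩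
  haveI : PreconnectedSpace (Model n) := inferInstance
  letI m : EMetricSpace (Model n) := EMetricSpace.ofRiemannianMetric 𝓘(ℝ, Model n) (Model n)
  @EMetricSpace.toMetricSpace _ m fun x y =>
    @edist_ne_top_of_preconnectedSpace (Model n) m.toPseudoEMetricSpace ‹_› x y

/-- The space `ℝⁿ` with the warped metric. This is a type synonym, because `ℝⁿ` already carries its
Euclidean distance and metric. -/
def WarpedSpace (_ : WarpExponent) : Type := Model n

instance : MetricSpace (WarpedSpace n Q) := warpedMetricSpace n Q

instance : ChartedSpace (Model n) (WarpedSpace n Q) :=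
  (inferInstance : ChartedSpace (Model n) (Model n))

instance : IsManifold 𝓘(ℝ, Model n) ∞ (WarpedSpace n Q) :=
  (inferInstance : IsManifold 𝓘(ℝ, Model n) ∞ (Model n))

instance : RiemannianBundle (fun x : WarpedSpace n Q => TangentSpace 𝓘(ℝ, Model n) x) :=
  ⟨(warpedRiemannianMetric n Q).toRiemannianMetric⟩

instance : IsContMDiffRiemannianBundle 𝓘(ℝ, Model n) ∞ (Model n)
    (fun x : WarpedSpace n Q => TangentSpace 𝓘(ℝ, Model n) x) :=
  ⟨(warpedRiemannianMetric n Q).inner, (warpedRiemannianMetric n Q).contMDiff, fun _ _ _ => rfl⟩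

instance : IsRiemannianManifold 𝓘(ℝ, Model n) (WarpedSpace n Q) := ⟨fun _ _ => rfl⟩

/-- The identity, as polar coordinates on the warped space. -/
def warpedChart : Diffeomorph 𝓘(ℝ, Model n) 𝓘(ℝ, Model n) (Model n) (WarpedSpace n Q) ∞ :=
  Diffeomorph.refl 𝓘(ℝ, Model n) (Model n) ∞

lemma mfderiv_warpedChart (y u : Model n) :
    mfderiv 𝓘(ℝ, Model n) 𝓘(ℝ, Model n) (warpedChart n Q) y u = u :=
  congrArg (fun L => L u) (mfderiv_id (I := 𝓘(ℝ, Model n)) (x := y))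

lemma isPolarChart_warpedChart :
    IsPolarChart (fun t => t * Real.exp (Q.toFun t)) (warpedChart n Q) where
  pos t ht := mul_pos ht (Real.exp_pos _)
  inner_eq y hy u v := by
    rw [mfderiv_warpedChart, mfderiv_warpedChart]
    exact warpedForm_polar Q (E := Model n) hy u v

end WarpedSpace

end

/-! ### Connections on a vector space -/

noncomputable section

section VectorSpaceConnection

variable {E : Type*} [NormedAddCommGroup E] [NormedSpace ℝ E]

lemma differentiableAt_of_mdifferentiableAt_section {Y : ∀ z : E, TangentSpace 𝓘(ℝ, E) z} {x : E}
    (h : MDifferentiableAt 𝓘(ℝ, E) (𝓘(ℝ, E).prod 𝓘(ℝ, E))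
      (fun z => (⟨z, Y z⟩ : TangentBundle 𝓘(ℝ, E) E)) x) :
    DifferentiableAt ℝ (fun z => (Y z : E)) x := by
  have h1 := ((mdifferentiableAt_totalSpace _ _).mp h).2
  refine (mdifferentiableAt_iff_differentiableAt.mp h1).congr_of_eventuallyEq
    (Filter.Eventually.of_forall fun z => ?_)
  simp
  rfl

lemma mvfderiv_vectorSpace {F : Type*} [NormedAddCommGroup F] [NormedSpace ℝ F] (g : E → F)
    (x : E) : (mvfderiv 𝓘(ℝ, E) g x : E →L[ℝ] F) = fderiv ℝ g x := by
  rw [← mfderiv_eq_fderiv]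
  rfl

/-- The covariant derivative `v ↦ DY(v) + Γ(Y, v)` of a vector field on a vector space. -/
def christoffelDerivative (Γ : E → E →L[ℝ] E →L[ℝ] E) (Y : E → E) (x : E) : E →L[ℝ] E :=
  fderiv ℝ Y x + Γ x (Y x)

lemma christoffelDerivative_add (Γ : E → E →L[ℝ] E →L[ℝ] E) {Y Z : E → E} {x : E}
    (hY : DifferentiableAt ℝ Y x) (hZ : DifferentiableAt ℝ Z x) :
    christoffelDerivative Γ (Y + Z) x =
      christoffelDerivative Γ Y x + christoffelDerivative Γ Z x := by
  rw [christoffelDerivative, fderiv_add hY hZ, Pi.add_apply, map_add, add_add_add_comm]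
  rfl

lemma christoffelDerivative_smul (Γ : E → E →L[ℝ] E →L[ℝ] E) {Y : E → E} {g : E → ℝ} {x : E}
    (hY : DifferentiableAt ℝ Y x) (hg : DifferentiableAt ℝ g x) :
    christoffelDerivative Γ (g • Y) x =
      g x • christoffelDerivative Γ Y x + (fderiv ℝ g x).smulRight (Y x) := by
  rw [christoffelDerivative, fderiv_smul hg hY, Pi.smul_apply', (Γ x).map_smul,
    christoffelDerivative, smul_add]
  abel

/-- The connection on a vector space with the given Christoffel symbols. -/
def christoffelConnection (Γ : E → E →L[ℝ] E →L[ℝ] E) :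
    CovariantDerivative 𝓘(ℝ, E) E (fun x : E => TangentSpace 𝓘(ℝ, E) x) where
  toFun := christoffelDerivative Γ
  isCovariantDerivativeOnUniv :=
    { add := fun hY hZ _ => christoffelDerivative_add Γ
        (differentiableAt_of_mdifferentiableAt_section hY)
        (differentiableAt_of_mdifferentiableAt_section hZ)
      leibniz := fun {Y g x} hY hg _ => by
        have h := christoffelDerivative_smul Γ
          (differentiableAt_of_mdifferentiableAt_section hY)
          (mdifferentiableAt_iff_differentiableAt.mp hg)
        rw [← mvfderiv_vectorSpace] at h
        exact h }

lemma torsion_christoffelConnection [FiniteDimensional ℝ E] [CompleteSpace E]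
    {Γ : E → E →L[ℝ] E →L[ℝ] E} (hΓ : ∀ x v w, Γ x w v = Γ x v w) :
    (christoffelConnection Γ).torsion = 0 := by
  rw [CovariantDerivative.torsion_eq_zero_iff]
  intro X Y x hX hY
  have h : VectorField.mlieBracket 𝓘(ℝ, E) X Y x =
      fderiv ℝ (fun z => (Y z : E)) x (X x) - fderiv ℝ (fun z => (X z : E)) x (Y x) := by
    rw [← VectorField.mlieBracketWithin_univ, VectorField.mlieBracketWithin_eq_lieBracketWithin]
    exact congrFun (VectorField.lieBracketWithin_univ (𝕜 := ℝ) (V := X) (W := Y)) x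
  rw [h]
  change (fderiv ℝ (fun z => (Y z : E)) x (X x) + Γ x (Y x) (X x)) -
    (fderiv ℝ (fun z => (X z : E)) x (Y x) + Γ x (X x) (Y x)) =
      fderiv ℝ (fun z => (Y z : E)) x (X x) - fderiv ℝ (fun z => (X z : E)) x (Y x)
  rw [hΓ x (X x) (Y x)]
  abel

end VectorSpaceConnection

section PolarComplete

variable {n : ℕ} {M : Type*} [MetricSpace M] [ChartedSpace (Model n) M]
  [RiemannianBundle (fun x : M => TangentSpace 𝓘(ℝ, Model n) x)]
  [IsRiemannianManifold 𝓘(ℝ, Model n) M]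
  {f : ℝ → ℝ} {Φ : Diffeomorph 𝓘(ℝ, Model n) 𝓘(ℝ, Model n) (Model n) M ∞}

/-- Balls around the pole are images of Euclidean balls, hence relatively compact. -/
lemma IsPolarChart.completeSpace (h : IsPolarChart f Φ) : CompleteSpace M := by
  have hball : ∀ r : ℝ, Metric.closedBall (Φ 0) r = Φ '' Metric.closedBall 0 r := by
    intro r
    ext x
    obtain ⟨y, rfl⟩ := Φ.surjective x
    change Φ y ∈ _ ↔ Φ y ∈ _
    rw [Function.Injective.mem_set_image (f := Φ) Φ.injective, Metric.mem_closedBall,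
      h.dist_eq_norm, mem_closedBall_zero_iff]
  have hp : ProperSpace M := ProperSpace.of_seq_closedBall (x := Φ 0) Filter.tendsto_id
    (Filter.Eventually.of_forall fun r => by
      rw [id, hball]
      exact (isCompact_closedBall 0 r).image Φ.continuous)
  infer_instance

end PolarComplete

section WarpedConnection

variable {n : ℕ} {Q : WarpExponent} {Γ : Model n → Model n →L[ℝ] Model n →L[ℝ] Model n}

/-- A connection on `ℝⁿ`, as a connection on the warped space. -/
def warpedConnection (n : ℕ) (Q : WarpExponent)
    (Γ : Model n → Model n →L[ℝ] Model n →L[ℝ] Model n) : AffineConnection n (WarpedSpace n Q) :=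
  christoffelConnection Γ

lemma isLeviCivita_warpedConnection
    (hΓ : ∀ y, IsChristoffel (warpedForm Q y) (fderiv ℝ (warpedForm Q) y) (Γ y)) :
    IsLeviCivita (warpedConnection n Q Γ) := by
  refine ⟨torsion_christoffelConnection fun x v w =>
    (hΓ x).symm (warpedForm_pos Q x) (fderiv_warpedForm_symm Q x) v w, ?_⟩
  have hb : IsContMDiffRiemannianBundle 𝓘(ℝ, Model n) 1 (Model n)
      (fun x : WarpedSpace n Q => TangentSpace 𝓘(ℝ, Model n) x) :=
    IsContMDiffRiemannianBundle.of_le (n := ∞) (by norm_cast)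
  rw [CovariantDerivative.isMetricCompatible_iff]
  intro x X σ τ hX hσ hτ
  let x' : Model n := x
  let s : Model n → Model n := σ
  let t : Model n → Model n := τ
  let v : Model n := X x
  have hs : DifferentiableAt ℝ s x' := differentiableAt_of_mdifferentiableAt_section hσ
  have ht : DifferentiableAt ℝ t x' := differentiableAt_of_mdifferentiableAt_section hτ
  have hd := ((contDiff_warpedForm Q (E := Model n)).differentiable (by simp) x').hasFDerivAt
  have h1 := ((hd.clm_apply hs.hasFDerivAt).clm_apply ht.hasFDerivAt).fderiv
  have h2 := congrArg (fun L => L v) h1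
  rw [← mvfderiv_vectorSpace] at h2
  have h3 := (hΓ x').add_eq (warpedForm_symm Q x') (fderiv_warpedForm_symm Q x') v (s x') (t x')
  have h4 : (mvfderiv 𝓘(ℝ, Model n) (fun z => warpedForm Q z (s z) (t z)) x' : Model n →L[ℝ] ℝ) v
      = warpedForm Q x' (christoffelDerivative Γ s x' v) (t x') +
        warpedForm Q x' (s x') (christoffelDerivative Γ t x' v) := by
    refine h2.trans ?_
    simp only [christoffelDerivative, add_apply, ContinuousLinearMap.comp_apply,
      ContinuousLinearMap.flip_apply, map_add]
    rw [← h3]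
    ring
  exact h4

/-- `Δr = (n - 1) f'/f`, where `f'/f = 1/r + Q'(r)`. -/
lemma laplaceBeltrami_dist_warpedSpace
    (hΓ : ∀ y, IsChristoffel (warpedForm Q y) (fderiv ℝ (warpedForm Q) y) (Γ y))
    {y : Model n} (hy : y ≠ 0) :
    laplaceBeltrami (warpedConnection n Q Γ) (fun x => dist x (warpedChart n Q 0))
      (warpedChart n Q y) = (‖y‖⁻¹ + deriv Q.toFun ‖y‖) * (n - 1) := by
  let X : Model n → Model n := fun z =>
    riemGradient (n := n) (fun x => dist x (warpedChart n Q 0)) (warpedChart n Q z)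
  have hX : X =ᶠ[𝓝 y] fun z => ‖z‖⁻¹ • z := by
    filter_upwards [isOpen_compl_singleton.mem_nhds hy] with z hz
    exact ((isPolarChart_warpedChart n Q).riemGradient_dist hz).trans
      (mfderiv_warpedChart n Q z _)
  have hT : ∀ v, christoffelDerivative Γ X y v =
      (‖y‖⁻¹ + deriv Q.toFun ‖y‖) • tangentialPart y v := by
    intro v
    rw [christoffelDerivative, hX.fderiv_eq, hX.eq_of_nhds]
    exact radial_covariant_derivative hy (hΓ y) v
  have h := trace_tangentialPart hy _ (T := (christoffelDerivative Γ X y).toLinearMap) hT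
  rw [finrank_euclideanSpace_fin] at h
  exact h

end WarpedConnection

end

/-! ### Sharpness -/

noncomputable section

/-- The exponent `Q` with `Q(t) = 0` for `t ≤ 1/2` and `1/t + Q'(t) = F(t)` for `t > 1`, so that
`f(t) = t exp(Q(t))` satisfies `f'/f = F` on `(1, ∞)`. -/
def WarpExponent.ofLogDeriv (F : ℝ → ℝ) (hF : ContDiff ℝ ∞ F) : WarpExponent where
  toFun t := ∫ τ in (0 : ℝ)..t, radialCutoff τ * (F τ - τ⁻¹)
  contDiff := contDiff_infty.mpr fun k =>
    (contDiff_integral_of_contDiff (contDiff_radialCutoff_mul (k := k) (by exact_mod_cast le_top)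
      fun _ ht => (hF.of_le (by exact_mod_cast le_top)).contDiffAt.sub
        (contDiffAt_inv ℝ ht.ne'))).of_le (by exact_mod_cast Nat.le_succ k)
  eq_zero _ ht := integral_radialCutoff_mul_of_le _ ht

lemma WarpExponent.deriv_ofLogDeriv {F : ℝ → ℝ} (hF : ContDiff ℝ ∞ F) {t : ℝ} (ht : 1 < t) :
    deriv (WarpExponent.ofLogDeriv F hF).toFun t = F t - t⁻¹ := by
  have hc : Continuous fun τ => radialCutoff τ * (F τ - τ⁻¹) :=
    (contDiff_radialCutoff_mul (k := 0) (by exact_mod_cast le_top) fun _ ht =>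
      (hF.of_le (by exact_mod_cast le_top)).contDiffAt.sub (contDiffAt_inv ℝ ht.ne')).continuous
  have h := (hc.integral_hasStrictDerivAt 0 t).hasDerivAt.deriv
  rw [radialCutoff_of_one_le ht.le, one_mul] at h
  exact h

/-- A smooth function `F` is the Laplacian of the distance function of a complete rotationally
symmetric metric on `ℝⁿ`, outside the unit ball. -/
lemma exists_laplaceBeltrami_dist_eq {n : ℕ} (hn : 2 ≤ n) {F : ℝ → ℝ} (hF : ContDiff ℝ ∞ F) :
    ∃ (Q : WarpExponent) (cov : AffineConnection n (WarpedSpace n Q)), IsLeviCivita cov ∧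
      ∀ x, 1 < dist x (warpedChart n Q 0) →
        laplaceBeltrami cov (fun z => dist z (warpedChart n Q 0)) x =
          F (dist x (warpedChart n Q 0)) := by
  let Q := WarpExponent.ofLogDeriv (fun t => F t / (n - 1)) (hF.div_const _)
  obtain ⟨Γ, hΓ⟩ := exists_isChristoffel_warpedForm Q (E := Model n)
  refine ⟨Q, warpedConnection n Q Γ, isLeviCivita_warpedConnection hΓ, fun x hx => ?_⟩
  obtain ⟨y, rfl⟩ := (warpedChart n Q).surjective x
  change 1 < dist (warpedChart n Q y) (warpedChart n Q 0) at hx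
  have hd := (isPolarChart_warpedChart n Q).dist_eq_norm y
  rw [hd] at hx
  have hy : y ≠ 0 := norm_pos_iff.mp (one_pos.trans hx)
  have hn1 : (n : ℝ) - 1 ≠ 0 := by
    have : (2 : ℝ) ≤ n := by exact_mod_cast hn
    linarith
  refine (laplaceBeltrami_dist_warpedSpace hΓ hy).trans ?_
  rw [WarpExponent.deriv_ofLogDeriv _ hx, add_sub_cancel, div_mul_cancel₀ _ hn1]
  exact congrArg F hd.symm

end

theorem mainTheorem3 (G : ℝ → ℝ) (hG : IsGrowthFunction G)
    (hfin : FiniteReciprocalIntegral G) :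
    (∃ H : ℝ → ℝ, IsTamedMinorant G H) ∧
    (∀ (n : ℕ) (_ : 1 ≤ n) (M : Type u) [MetricSpace M] [ChartedSpace (Model n) M]
      [IsManifold 𝓘(ℝ, Model n) ∞ M]
      [RiemannianBundle (fun x : M => TangentSpace 𝓘(ℝ, Model n) x)]
      [IsContMDiffRiemannianBundle 𝓘(ℝ, Model n) ∞ (Model n)
        (fun x : M => TangentSpace 𝓘(ℝ, Model n) x)]
      [IsRiemannianManifold 𝓘(ℝ, Model n) M]
      (cov : AffineConnection n M) (_ : IsLeviCivita cov) (_ : IsHadamard cov)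
      (p : M) (_ : IsRotationallySymmetric (n := n) p)
      (_ : ∀ x : M, x ≠ p → G (dist x p) < laplaceBeltrami cov (fun y => dist y p) x),
      (∀ (H : ℝ → ℝ) (_ : IsTamedMinorant G H) (h : M → ℝ)
        (_ : ∀ x, h x = ∫ t in (0 : ℝ)..dist x p, 1 / H t),
        (∃ C : ℝ, ∀ x, |h x| ≤ C) ∧
        ContMDiffOn 𝓘(ℝ, Model n) 𝓘(ℝ, ℝ) 2 h {p}ᶜ ∧
        ∀ x : M, x ≠ p → 1 < laplaceBeltrami cov h x) ∧
      ¬ OmoriYau cov) ∧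
    (∀ (n : ℕ) (_ : 2 ≤ n),
      ∃ (M : Type) (_ : MetricSpace M) (_ : ChartedSpace (Model n) M)
        (_ : IsManifold 𝓘(ℝ, Model n) ∞ M)
        (_ : RiemannianBundle (fun x : M => TangentSpace 𝓘(ℝ, Model n) x))
        (_ : IsContMDiffRiemannianBundle 𝓘(ℝ, Model n) ∞ (Model n)
          (fun x : M => TangentSpace 𝓘(ℝ, Model n) x))
        (_ : IsRiemannianManifold 𝓘(ℝ, Model n) M)
        (cov : AffineConnection n M) (p : M),
        CompleteSpace M ∧ IsLeviCivita cov ∧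
        (∀ x : M, ContMDiffAt 𝓘(ℝ, Model n) 𝓘(ℝ, ℝ) ∞ (fun y => dist y p) x → 1 < dist x p →
          laplaceBeltrami cov (fun y => dist y p) x ≤ G (dist x p)) ∧
        ¬ OmoriYau cov) := by
  obtain ⟨H, hH, hHC⟩ := hG.exists_contDiff_isTamedMinorant hfin
  refine ⟨⟨H, hH⟩, ?_, ?_⟩
  · intro n hn M _ _ _ _ _ _ cov _ _ p hp hΔ
    obtain ⟨f, Φ, hf, rfl, hΦ⟩ := hp
    have hP : IsPolarChart f Φ := ⟨hf, hΦ⟩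
    refine ⟨fun K hK w hw => hP.integral_comp_dist cov hΔ hK hw,
      hP.not_omoriYau hn cov hH fun x hx => ?_⟩
    have hr : 0 < dist x (Φ 0) := one_pos.trans hx
    exact (hH.two_mul_le _ hr.le).trans (hΔ x (dist_pos.mp hr)).le
  · intro n hn
    obtain ⟨Q, cov, hLC, hΔ⟩ :=
      exists_laplaceBeltrami_dist_eq hn (contDiff_const.mul hHC : ContDiff ℝ ∞ fun t => 2 * H t)
    have hP := isPolarChart_warpedChart n Q
    exact ⟨WarpedSpace n Q, inferInstance, inferInstance, inferInstance, inferInstance,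
      inferInstance, inferInstance, cov, warpedChart n Q 0, hP.completeSpace, hLC,
      fun x _ hx => (hΔ x hx).trans_le (hH.two_mul_le _ (zero_le_one.trans hx.le)),
      hP.not_omoriYau (one_le_two.trans hn) cov hH fun x hx => (hΔ x hx).ge⟩
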